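/- Let $\mathcal H^2$ be the hyperbolic plane of curvature $-1$ and let $M$ be a smooth surface, smoothly immersed in $\mathcal H^2\times\mathbb R$ (with the product metric), whose Gaussian curvature and extrinsic curvature (the product of the two principal curvatures) both vanish identically. A point of $M$ is planar if both principal curvatures vanish there, and parabolic if exactly one of them vanishes; let $P$ be the set of planar points. An asymptotic direction at a point of $M$ is a principal direction whose principal curvature is zero, and an asymptotic line is a regular $C^1$ curve in $M$, defined on a nondegenerate interval, all of whose tangent vectors are in asymptotic directions (it is allowed to meet $P$). It is maximal if it cannot be extended to an asymptotic line on a larger interval. Let $\gamma$ be an asymptotic line of $M$, parameterized by arc length $s\in I$, that passes through a parabolic point. Then: (1) If $M$ is complete in the induced metric and $\gamma$ is maximal, then $\gamma\cap P=\emptyset$. (2) $\gamma$ is a segment of a geodesic of $\mathcal H^2\times\mathbb R$. (3) There is a continuous unit normal field of $M$ along $\gamma$, and for each such field the mean curvature $H$ of $M$ along $\gamma$ with respect to it has no zero on $I$, the function $1/H$ is of class $C^2$ on $I$ with $$\frac{d^2}{ds^2}\left(\frac1H\right)=0,$$ and there are real constants $a,b$ such that $as+b\neq 0$ and $H(s)=\dfrac{1}{as+b}$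 for all $s\in I$. -/

import Mathlib

open Set Filter
open scoped Manifold ContDiff Topology

noncomputable section

namespace FlatSurface

/-- The coordinate space `ℝⁿ`. -/
abbrev E (n : ℕ) : Type := EuclideanSpace ℝ (Fin n)

/-- The `i`-th coordinate vector of `ℝⁿ`. -/
def coordVec {n : ℕ} (i : Fin n) : E n := EuclideanSpace.single i 1

/-- The partial derivative `∂ᵢ φ` at `x`. -/
def partialD {n : ℕ} (i : Fin n) (φ : E n → ℝ) (x : E n) : ℝ := fderiv ℝ φ x (coordVec i)

/-! ### Riemannian metrics in coordinates

A metric in coordinates is the matrix-valued function `g = (gᵢⱼ)`. -/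

/-- The inner product `g_x(v, w) = ∑ gᵢⱼ(x) vᵢ wⱼ`. -/
def metricInner {n : ℕ} (g : E n → Matrix (Fin n) (Fin n) ℝ) (x v w : E n) : ℝ :=
  ∑ i, ∑ j, g x i j * v i * w j

/-- Christoffel symbols of the first kind of the Levi-Civita connection,
`[ij, k] = ½ (∂ᵢ gⱼₖ + ∂ⱼ gᵢₖ - ∂ₖ gᵢⱼ) = g(∇_{∂ᵢ} ∂ⱼ, ∂ₖ)`. -/
def christoffelFirst {n : ℕ} (g : E n → Matrix (Fin n) (Fin n) ℝ) (i j k : Fin n) (x : E n) : ℝ :=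
  (partialD i (fun y => g y j k) x + partialD j (fun y => g y i k) x
    - partialD k (fun y => g y i j) x) / 2

/-- Christoffel symbols of the second kind, `Γᵏᵢⱼ = ∑ₗ gᵏˡ [ij, l]`. -/
def christoffel {n : ℕ} (g : E n → Matrix (Fin n) (Fin n) ℝ) (k i j : Fin n) (x : E n) : ℝ :=
  ∑ l, (g x)⁻¹ k l * christoffelFirst g i j l x

/-- The vector `Γ_x(v, w)` with components `∑ Γᵏᵢⱼ(x) vᵢ wⱼ`. -/
def christoffelVec {n : ℕ} (g : E n → Matrix (Fin n) (Fin n) ℝ) (x v w : E n) : E n :=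
  WithLp.toLp 2 fun k => ∑ i, ∑ j, christoffel g k i j x * v i * w j

/-- The curvature tensor `g(R(∂ᵢ, ∂ⱼ) ∂ₖ, ∂ₗ)`, where
`R(X, Y) = ∇_X ∇_Y - ∇_Y ∇_X - ∇_{[X, Y]}`, written through
`g(∇ᵢ ∇ⱼ ∂ₖ, ∂ₗ) = ∂ᵢ [jk, l] - g(∇ⱼ ∂ₖ, ∇ᵢ ∂ₗ)`. -/
def riemann {n : ℕ} (g : E n → Matrix (Fin n) (Fin n) ℝ) (i j k l : Fin n) (x : E n) : ℝ :=
  (partialD i (christoffelFirst g j k l) x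
      - ∑ a, ∑ b, (g x)⁻¹ a b * christoffelFirst g j k a x * christoffelFirst g i l b x)
    - (partialD j (christoffelFirst g i k l) x
      - ∑ a, ∑ b, (g x)⁻¹ a b * christoffelFirst g i k a x * christoffelFirst g j l b x)

/-- The Gaussian curvature `g(R(∂₀, ∂₁) ∂₁, ∂₀) / det g` of a metric in two variables. -/
def gaussOfMetric (g : E 2 → Matrix (Fin 2) (Fin 2) ℝ) (x : E 2) : ℝ :=
  riemann g 0 1 1 0 x / (g x).det

/-- A curve `c`, given in coordinates on the interval `I`, is a geodesic of `g`:
`c'' + Γ(c', c') = 0` (derivatives at endpoints of `I` are one-sided). -/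
def IsGeodesicOn {n : ℕ} (g : E n → Matrix (Fin n) (Fin n) ℝ) (c : ℝ → E n) (I : Set ℝ) : Prop :=
  ContDiffOn ℝ ∞ c I ∧ ∀ s ∈ I,
    derivWithin (derivWithin c I) I s
      + christoffelVec g (c s) (derivWithin c I s) (derivWithin c I s) = 0

/-! ### The ambient space `ℍ² × ℝ` -/

/-- The global chart `(x + i y, t) ↦ (x, y, t)` of `ℍ² × ℝ`, `ℍ²` the upper half-plane. -/
def coords (q : UpperHalfPlane × ℝ) : E 3 := !₂[q.1.re, q.1.im, q.2]

/-- The product metric `(dx² + dy²) / y² + dt²`; its first factor is the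
metric of curvature `-1` on the upper half-plane. -/
def ambientMetric (q : E 3) : Matrix (Fin 3) (Fin 3) ℝ :=
  Matrix.diagonal ![1 / q 1 ^ 2, 1 / q 1 ^ 2, 1]

section Surface

variable {M : Type*} [TopologicalSpace M] [ChartedSpace (E 2) M]

/-! ### Surfaces immersed in `ℍ² × ℝ`

Tangent vectors of `M` at `p` are represented in `ℝ²` through the preferred chart at `p`, as for
Mathlib's `TangentSpace`; tangent vectors of `ℍ² × ℝ` are represented in `ℝ³` through `coords`. -/

/-- The local parametrization `u ↦ (x, y, t)(u)` of the surface, by the preferred chart at `p`. -/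
def localParam (f : M → UpperHalfPlane × ℝ) (p : M) (u : E 2) : E 3 :=
  coords (f ((extChartAt (𝓡 2) p).symm u))

/-- The coordinates of `p` itself in the preferred chart at `p`. -/
def basePt (p : M) : E 2 := extChartAt (𝓡 2) p p

/-- The differential of `f` at `p`. -/
def diff (f : M → UpperHalfPlane × ℝ) (p : M) : E 2 →L[ℝ] E 3 :=
  fderiv ℝ (localParam f p) (basePt p)

/-- `f` is a smooth immersion of the surface `M` in `ℍ² × ℝ`. -/
def IsSmoothImmersion (f : M → UpperHalfPlane × ℝ) : Prop :=
  ContMDiff (𝓡 2) 𝓘(ℝ, E 3) ∞ (fun p => coords (f p)) ∧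
    ∀ p, Function.Injective (diff f p)

/-- The first fundamental form (induced metric) at `p`. -/
def firstForm (f : M → UpperHalfPlane × ℝ) (p : M) (v w : E 2) : ℝ :=
  metricInner ambientMetric (coords (f p)) (diff f p v) (diff f p w)

/-- The induced metric in the preferred chart at `p`, as a function of the chart coordinates. -/
def inducedMetric (f : M → UpperHalfPlane × ℝ) (p : M) (u : E 2) : Matrix (Fin 2) (Fin 2) ℝ :=
  Matrix.of fun i j => metricInner ambientMetric (localParam f p u)
    (fderiv ℝ (localParam f p) u (coordVec i)) (fderiv ℝ (localParam f p) u (coordVec j))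

/-- The (intrinsic) Gaussian curvature of the surface at `p`. -/
def gaussianCurvature (f : M → UpperHalfPlane × ℝ) (p : M) : ℝ :=
  gaussOfMetric (inducedMetric f p) (basePt p)

/-- `N` is a unit normal vector of the surface at `p`. -/
def IsUnitNormal (f : M → UpperHalfPlane × ℝ) (p : M) (N : E 3) : Prop :=
  metricInner ambientMetric (coords (f p)) N N = 1 ∧
    ∀ v, metricInner ambientMetric (coords (f p)) (diff f p v) N = 0

/-- The second fundamental form at `p` with respect to the normal vector `N`: the component along
`N` of the ambient covariant derivative `∂ᵥ ∂_w F + Γ(∂ᵥ F, ∂_w F)`. -/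
def secondForm (f : M → UpperHalfPlane × ℝ) (p : M) (N : E 3) (v w : E 2) : ℝ :=
  metricInner ambientMetric (coords (f p))
    (fderiv ℝ (fderiv ℝ (localParam f p)) (basePt p) v w
      + christoffelVec ambientMetric (coords (f p)) (diff f p v) (diff f p w)) N

/-- The matrix of the shape operator in the preferred chart at `p`. -/
def shapeMatrix (f : M → UpperHalfPlane × ℝ) (p : M) (N : E 3) : Matrix (Fin 2) (Fin 2) ℝ :=
  (Matrix.of fun i j => firstForm f p (coordVec i) (coordVec j))⁻¹ *
    Matrix.of fun i j => secondForm f p N (coordVec i) (coordVec j)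

/-- The extrinsic curvature: the determinant of the shape operator, which is
the product of the principal curvatures. -/
def extrinsicCurvature (f : M → UpperHalfPlane × ℝ) (p : M) (N : E 3) : ℝ :=
  (shapeMatrix f p N).det

/-- The mean curvature: half the trace of the shape operator. -/
def meanCurvature (f : M → UpperHalfPlane × ℝ) (p : M) (N : E 3) : ℝ :=
  (shapeMatrix f p N).trace / 2

/-- `v` is a principal direction at `p` with principal curvature `k`. -/
def IsPrincipal (f : M → UpperHalfPlane × ℝ) (p : M) (N : E 3) (k : ℝ) (v : E 2) : Prop :=
  v ≠ 0 ∧ ∀ w, secondForm f p N v w = k * firstForm f p v w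

/-- Planar points: both principal curvatures vanish. -/
def IsPlanar (f : M → UpperHalfPlane × ℝ) (p : M) : Prop :=
  ∃ N, IsUnitNormal f p N ∧ ∀ k v, IsPrincipal f p N k v → k = 0

/-- Parabolic points: one principal curvature vanishes and the other does not. -/
def IsParabolic (f : M → UpperHalfPlane × ℝ) (p : M) : Prop :=
  ∃ N, IsUnitNormal f p N ∧
    (∃ v, IsPrincipal f p N 0 v) ∧ ∃ k v, k ≠ 0 ∧ IsPrincipal f p N k v

/-- Asymptotic directions: principal directions with principal curvature zero. -/
def IsAsymptoticDir (f : M → UpperHalfPlane × ℝ) (p : M) (v : E 2) : Prop :=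
  ∃ N, IsUnitNormal f p N ∧ IsPrincipal f p N 0 v

/-- The velocity at `s` of a curve `γ` in `M` with parameter interval `I`. -/
def velocity (γ : ℝ → M) (I : Set ℝ) (s : ℝ) : E 2 :=
  derivWithin (fun r => extChartAt (𝓡 2) (γ s) (γ r)) I s

/-- `γ`, on the nondegenerate interval `I` (open or not, bounded or not), is an asymptotic line of
the surface parameterized by arc length. It is not required to avoid the planar points. -/
structure IsAsymptoticLine (f : M → UpperHalfPlane × ℝ) (γ : ℝ → M) (I : Set ℝ) : Prop where
  interval : I.OrdConnected
  nondegenerate : I.Nontrivial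
  contMDiffOn : ContMDiffOn 𝓘(ℝ, ℝ) (𝓡 2) 1 γ I
  arcLength : ∀ s ∈ I, firstForm f (γ s) (velocity γ I s) (velocity γ I s) = 1
  asymptotic : ∀ s ∈ I, IsAsymptoticDir f (γ s) (velocity γ I s)

/-- An asymptotic line that is not the restriction of one on a larger interval. -/
def IsMaximalAsymptoticLine (f : M → UpperHalfPlane × ℝ) (γ : ℝ → M) (I : Set ℝ) : Prop :=
  IsAsymptoticLine f γ I ∧
    ∀ (δ : ℝ → M) (J : Set ℝ), IsAsymptoticLine f δ J → I ⊆ J → EqOn δ γ I → J = I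

/-- `N` is a continuous field of unit normal vectors of the surface along `γ`. -/
def IsUnitNormalAlong (f : M → UpperHalfPlane × ℝ) (γ : ℝ → M) (I : Set ℝ) (N : ℝ → E 3) : Prop :=
  ContinuousOn N I ∧ ∀ s ∈ I, IsUnitNormal f (γ s) (N s)

/-- The length, in the induced metric, of a curve `c : [0, 1] → M`. -/
def pathLength (f : M → UpperHalfPlane × ℝ) (c : ℝ → M) : ENNReal :=
  ∫⁻ s in Icc (0 : ℝ) 1, ENNReal.ofReal (Real.sqrt
    (firstForm f (c s) (velocity c (Icc 0 1) s) (velocity c (Icc 0 1) s)))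

/-- The distance of the induced metric: the infimum of the lengths of the `C¹` curves from
`p` to `q` (it is `∞` if there are none). -/
def surfaceDist (f : M → UpperHalfPlane × ℝ) (p q : M) : ENNReal :=
  ⨅ (c : ℝ → M) (_ : ContMDiffOn 𝓘(ℝ, ℝ) (𝓡 2) 1 c (Icc 0 1)) (_ : c 0 = p) (_ : c 1 = q),
    pathLength f c

/-- The surface is complete: Cauchy sequences of the induced distance converge. -/
def IsCompleteSurface (f : M → UpperHalfPlane × ℝ) : Prop :=
  ∀ u : ℕ → M,
    (∀ ε : ENNReal, 0 < ε → ∃ n₀, ∀ m ≥ n₀, ∀ n ≥ n₀, surfaceDist f (u m) (u n) < ε) →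
    ∃ p, Tendsto u atTop (𝓝 p)

end Surface

end FlatSurface

end

open FlatSurface

noncomputable section

namespace FlatSurface

/-! In `ℍ² × ℝ` the sectional curvature of a tangent plane with unit normal `N` is `-⟨N, ∂ₜ⟩²`, so
the Gauss equation reads `K = K_ext - ⟨N, ∂ₜ⟩²`. If both curvatures vanish, then `N` is horizontal
and every tangent plane contains `∂ₜ` (`horizontal_minor_eq_zero`, `diff_horizontal_minor`). The
inverse function theorem then presents the surface locally as a vertical cylinder over a regular
curve `β` of `ℍ²`, with coordinates `(σ, t)` (`exists_cylinder`, `exists_isCylinderAt`).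

On such a cylinder the principal curvatures are `0`, in the direction `∂ₜ`, and the geodesic
curvature of `β` up to sign. Hence `H²` is a function of `σ` alone, namely `κ² / (4 B³)` with `κ =
profileCurv β σ` and `B = profileSpeed β σ` (`meanCurvature_sq`). A vector in an asymptotic
direction satisfies `κ dσ = 0` (`diff_mul_curv_eq_zero`). Every term of the derivative of `H²` along
an asymptotic line contains `κ σ'`, so `H²` is constant there, even across planar points.

One parabolic point makes this constant positive. Thus no planar point is met, `κ ≠ 0` throughout,
and `σ' = 0`: the line is vertical, hence a geodesic. The conditions for a unit normal do not change
along it, and a continuous normal field gives a continuous `H` with constant nonzero square on an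
interval, so `H` is constant and `1/H` is affine with slope `0`. -/

/-! ### The ambient metric and its connection -/

lemma metricInner_ambient (x v w : E 3) :
    metricInner ambientMetric x v w = (v 0 * w 0 + v 1 * w 1) / x 1 ^ 2 + v 2 * w 2 := by
  simp [metricInner, ambientMetric, Fin.sum_univ_three]
  ring

lemma hasFDerivAt_coord {n : ℕ} (i : Fin n) (x : E n) :
    HasFDerivAt (fun y : E n => y i) (EuclideanSpace.proj (𝕜 := ℝ) i : E n →L[ℝ] ℝ) x :=
  (EuclideanSpace.proj (𝕜 := ℝ) i : E n →L[ℝ] ℝ).hasFDerivAt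

lemma partialD_inv_sq (k : Fin 3) (x : E 3) (hx : x 1 ≠ 0) :
    partialD k (fun y : E 3 => 1 / y 1 ^ 2) x = if k = 1 then -2 / x 1 ^ 3 else 0 := by
  have h1 : HasDerivAt (fun s : ℝ => 1 / s ^ 2) (-2 / x 1 ^ 3) (x 1) := by
    have := (hasDerivAt_pow 2 (x 1)).fun_inv (pow_ne_zero 2 hx)
    simp only [one_div]
    refine this.congr_deriv ?_
    simp
    field_simp
  have := h1.comp_hasFDerivAt x (hasFDerivAt_coord 1 x)
  rw [partialD]
  erw [this.fderiv]
  fin_cases k <;> simp [coordVec]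

lemma partialD_const {n : ℕ} (k : Fin n) (c : ℝ) (x : E n) : partialD k (fun _ => c) x = 0 := by
  simp [partialD]

lemma partialD_ambientMetric (i j k : Fin 3) (x : E 3) (hx : x 1 ≠ 0) :
    partialD k (fun y => ambientMetric y i j) x =
      if k = 1 ∧ i = j ∧ i ≠ 2 then -2 / x 1 ^ 3 else 0 := by
  have h := partialD_inv_sq k x hx
  fin_cases i <;> fin_cases j <;>
    simp [ambientMetric, partialD_const] <;> simpa using h

lemma christoffelVec_ambient (x v w : E 3) (hx : x 1 ≠ 0) :
    christoffelVec ambientMetric x v w =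
      !₂[-(v 0 * w 1 + v 1 * w 0) / x 1, (v 0 * w 0 - v 1 * w 1) / x 1, 0] := by
  have hinv : (ambientMetric x)⁻¹ = Matrix.diagonal ![x 1 ^ 2, x 1 ^ 2, 1] := by
    apply Matrix.inv_eq_left_inv
    rw [ambientMetric, Matrix.diagonal_mul_diagonal, ← Matrix.diagonal_one]
    congr 1
    ext i
    fin_cases i <;> simp [hx]
  ext k
  simp only [christoffelVec, christoffel, christoffelFirst, partialD_ambientMetric _ _ _ _ hx, hinv]
  fin_cases k <;> simp [Fin.sum_univ_three, Matrix.diagonal] <;> field_simp <;> ring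

/-! ### Partial derivatives of smooth maps -/

/-- Smooth on a neighbourhood of `u`. -/
def SmoothNear {n : ℕ} {G : Type*} [NormedAddCommGroup G] [NormedSpace ℝ G] (φ : E n → G)
    (u : E n) : Prop := ∀ᶠ v in 𝓝 u, ContDiffAt ℝ ∞ φ v

lemma _root_.ContDiffAt.partialD {n : ℕ} {φ : E n → ℝ} {u : E n} (h : ContDiffAt ℝ ∞ φ u)
    (i : Fin n) : ContDiffAt ℝ ∞ (partialD i φ) u :=
  (h.fderiv_right (m := ∞) (by simp)).clm_apply contDiffAt_const

lemma _root_.ContDiffAt.hasFDerivAt_of_smooth {n : ℕ} {φ : E n → ℝ} {u : E n}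
    (h : ContDiffAt ℝ ∞ φ u) : HasFDerivAt φ (fderiv ℝ φ u) u :=
  (h.differentiableAt (by simp)).hasFDerivAt

lemma partialD_partialD {n : ℕ} {φ : E n → ℝ} {u : E n} (h : ContDiffAt ℝ ∞ φ u) (i j : Fin n) :
    partialD i (partialD j φ) u = fderiv ℝ (fderiv ℝ φ) u (coordVec i) (coordVec j) := by
  have h2 : DifferentiableAt ℝ (fderiv ℝ φ) u :=
    (h.fderiv_right (m := ∞) (by simp)).differentiableAt (by simp)
  have : HasFDerivAt (partialD j φ) _ u :=
    h2.hasFDerivAt.clm_apply (hasFDerivAt_const (coordVec j) u)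
  rw [partialD, this.fderiv]
  simp

lemma partialD_comm {n : ℕ} {φ : E n → ℝ} {u : E n} (h : ContDiffAt ℝ ∞ φ u) (i j : Fin n) :
    partialD i (partialD j φ) u = partialD j (partialD i φ) u := by
  rw [partialD_partialD h, partialD_partialD h]
  have := h.isSymmSndFDerivAt (by simpa using ENat.LEInfty.out)
  exact this _ _

lemma partialD_congr {n : ℕ} {φ ψ : E n → ℝ} {u : E n} (h : φ =ᶠ[𝓝 u] ψ) (i : Fin n) :
    partialD i φ u = partialD i ψ u := by
  rw [partialD, partialD, h.fderiv_eq]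

lemma _root_.ContDiffAt.coord {n : ℕ} {F : E n → E 3} {u : E n} (h : ContDiffAt ℝ ∞ F u)
    (k : Fin 3) : ContDiffAt ℝ ∞ (fun v => F v k) u :=
  (EuclideanSpace.proj (𝕜 := ℝ) k : E 3 →L[ℝ] ℝ).contDiff.contDiffAt.comp u h

lemma fderiv_coord {n : ℕ} {F : E n → E 3} {u : E n} (h : DifferentiableAt ℝ F u)
    (k : Fin 3) (w : E n) : fderiv ℝ F u w k = fderiv ℝ (fun v => F v k) u w := by
  have := (hasFDerivAt_coord k (F u)).comp u h.hasFDerivAt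
  have h2 : HasFDerivAt (fun v => F v k) _ u := this
  rw [h2.fderiv]
  rfl

lemma fderiv_fderiv_coord {n : ℕ} {F : E n → E 3} {u : E n} (h : SmoothNear F u)
    (k : Fin 3) (v w : E n) :
    fderiv ℝ (fderiv ℝ F) u v w k = fderiv ℝ (fderiv ℝ (fun v => F v k)) u v w := by
  have h0 := h.self_of_nhds
  have h2 : DifferentiableAt ℝ (fderiv ℝ F) u :=
    (h0.fderiv_right (m := ∞) (by simp)).differentiableAt (by simp)
  have h3 : DifferentiableAt ℝ (fderiv ℝ (fun v => F v k)) u :=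
    ((h0.coord k).fderiv_right (m := ∞) (by simp)).differentiableAt (by simp)
  have e : (fun u' => (fderiv ℝ F u' w k : ℝ)) =ᶠ[𝓝 u] fun u' => fderiv ℝ (fun v => F v k) u' w := by
    filter_upwards [h] with u' hu'
    exact fderiv_coord (hu'.differentiableAt (by simp)) k w
  have e2 := e.fderiv_eq (𝕜 := ℝ)
  have hw := h2.hasFDerivAt.clm_apply (hasFDerivAt_const w u)
  have d1 := (EuclideanSpace.proj (𝕜 := ℝ) k : E 3 →L[ℝ] ℝ).hasFDerivAt.comp u hw
  change HasFDerivAt (fun u' => fderiv ℝ F u' w k) _ u at d1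
  have d2 := h3.hasFDerivAt.clm_apply (hasFDerivAt_const w u)
  rw [d1.fderiv, d2.fderiv] at e2
  simpa using congrArg (fun l => l v) e2

/-! ### The Gauss equation for a parametrized surface -/

/-- The metric induced on the plane by a map `F` into the ambient chart. -/
def pullMetric (F : E 2 → E 3) (u : E 2) : Matrix (Fin 2) (Fin 2) ℝ :=
  Matrix.of fun i j => metricInner ambientMetric (F u)
    (fderiv ℝ F u (coordVec i)) (fderiv ℝ F u (coordVec j))

section Gauss

variable {F : E 2 → E 3} {u : E 2}

lemma pullMetric_apply (h : ContDiffAt ℝ ∞ F u) (i j : Fin 2) :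
    pullMetric F u i j =
      (partialD i (fun v => F v 0) u * partialD j (fun v => F v 0) u
        + partialD i (fun v => F v 1) u * partialD j (fun v => F v 1) u) / F u 1 ^ 2
      + partialD i (fun v => F v 2) u * partialD j (fun v => F v 2) u := by
  have hd := h.differentiableAt (by simp)
  simp only [pullMetric, Matrix.of_apply, metricInner_ambient, fderiv_coord hd, partialD]

lemma partialD_pullMetric (h : SmoothNear F u) (hy : F u 1 ≠ 0) (i j k : Fin 2) :
    partialD k (fun v => pullMetric F v i j) u =
      (partialD k (partialD i (fun v => F v 0)) u * partialD j (fun v => F v 0) u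
        + partialD i (fun v => F v 0) u * partialD k (partialD j (fun v => F v 0)) u
        + partialD k (partialD i (fun v => F v 1)) u * partialD j (fun v => F v 1) u
        + partialD i (fun v => F v 1) u * partialD k (partialD j (fun v => F v 1)) u) / F u 1 ^ 2
      - 2 * partialD k (fun v => F v 1) u * (partialD i (fun v => F v 0) u
          * partialD j (fun v => F v 0) u
          + partialD i (fun v => F v 1) u * partialD j (fun v => F v 1) u) / F u 1 ^ 3
      + partialD k (partialD i (fun v => F v 2)) u * partialD j (fun v => F v 2) u
        + partialD i (fun v => F v 2) u * partialD k (partialD j (fun v => F v 2)) u := by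
  have h0 := h.self_of_nhds
  have e := h.mono fun v hv => pullMetric_apply hv i j
  rw [partialD_congr e]
  have hx (m : Fin 3) := (h0.coord m).hasFDerivAt_of_smooth
  have hxx (m : Fin 3) (a : Fin 2) := ((h0.coord m).partialD a).hasFDerivAt_of_smooth
  have := ((((hxx 0 i).mul (hxx 0 j)).add ((hxx 1 i).mul (hxx 1 j))).mul
    ((hasDerivAt_inv (pow_ne_zero 2 hy)).comp_hasFDerivAt u ((hx 1).pow 2))).add
      ((hxx 2 i).mul (hxx 2 j))
  have e3 := this.fderiv
  have e4 := congrArg (fun l => l (coordVec k)) e3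
  -- The product rule was applied with division by `y²` written as multiplication by an inverse;
  -- `rfl` matches the two forms.
  refine Eq.trans (Eq.trans ?_ e4) ?_
  · rfl
  · simp [partialD]
    field_simp
    ring

/-- The right side is `⟨∇ᵢ ∂ⱼF, ∂ₖF⟩` for the ambient connection: the induced connection is the
tangential part of the ambient one. -/
lemma christoffelFirst_pullMetric (h : SmoothNear F u) (hy : F u 1 ≠ 0) (i j k : Fin 2) :
    christoffelFirst (pullMetric F) i j k u =
      (partialD i (partialD j (fun v => F v 0)) u * partialD k (fun v => F v 0) u
        + partialD i (partialD j (fun v => F v 1)) u * partialD k (fun v => F v 1) u) / F u 1 ^ 2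
      + partialD i (partialD j (fun v => F v 2)) u * partialD k (fun v => F v 2) u
      + (-(partialD i (fun v => F v 0) u * partialD j (fun v => F v 1) u
            + partialD i (fun v => F v 1) u * partialD j (fun v => F v 0) u)
            * partialD k (fun v => F v 0) u
          + (partialD i (fun v => F v 0) u * partialD j (fun v => F v 0) u
            - partialD i (fun v => F v 1) u * partialD j (fun v => F v 1) u)
            * partialD k (fun v => F v 1) u) / F u 1 ^ 3 := by
  have h0 := h.self_of_nhds
  rw [christoffelFirst, partialD_pullMetric h hy, partialD_pullMetric h hy,
    partialD_pullMetric h hy]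
  have c (m : Fin 3) := partialD_comm (h0.coord m)
  rw [c 0 j i, c 0 k i, c 0 k j, c 1 j i, c 1 k i, c 1 k j, c 2 j i, c 2 k i, c 2 k j]
  field_simp
  ring

lemma partialD_christoffelFirst_pullMetric (h : SmoothNear F u) (hy : F u 1 ≠ 0)
    (i j k l : Fin 2) :
    partialD l (christoffelFirst (pullMetric F) i j k) u =
      (partialD l (partialD i (partialD j (fun v => F v 0))) u * partialD k (fun v => F v 0) u
        + partialD i (partialD j (fun v => F v 0)) u * partialD l (partialD k (fun v => F v 0)) u
        + partialD l (partialD i (partialD j (fun v => F v 1))) u * partialD k (fun v => F v 1) u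
        + partialD i (partialD j (fun v => F v 1)) u * partialD l (partialD k (fun v => F v 1)) u)
        / F u 1 ^ 2
      - 2 * partialD l (fun v => F v 1) u *
        (partialD i (partialD j (fun v => F v 0)) u * partialD k (fun v => F v 0) u
        + partialD i (partialD j (fun v => F v 1)) u * partialD k (fun v => F v 1) u) / F u 1 ^ 3
      + partialD l (partialD i (partialD j (fun v => F v 2))) u * partialD k (fun v => F v 2) u
      + partialD i (partialD j (fun v => F v 2)) u * partialD l (partialD k (fun v => F v 2)) u
      + (-(partialD l (partialD i (fun v => F v 0)) u * partialD j (fun v => F v 1) u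
            + partialD i (fun v => F v 0) u * partialD l (partialD j (fun v => F v 1)) u
            + partialD l (partialD i (fun v => F v 1)) u * partialD j (fun v => F v 0) u
            + partialD i (fun v => F v 1) u * partialD l (partialD j (fun v => F v 0)) u)
            * partialD k (fun v => F v 0) u
          - (partialD i (fun v => F v 0) u * partialD j (fun v => F v 1) u
            + partialD i (fun v => F v 1) u * partialD j (fun v => F v 0) u)
            * partialD l (partialD k (fun v => F v 0)) u
          + (partialD l (partialD i (fun v => F v 0)) u * partialD j (fun v => F v 0) u
            + partialD i (fun v => F v 0) u * partialD l (partialD j (fun v => F v 0)) u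
            - partialD l (partialD i (fun v => F v 1)) u * partialD j (fun v => F v 1) u
            - partialD i (fun v => F v 1) u * partialD l (partialD j (fun v => F v 1)) u)
            * partialD k (fun v => F v 1) u
          + (partialD i (fun v => F v 0) u * partialD j (fun v => F v 0) u
            - partialD i (fun v => F v 1) u * partialD j (fun v => F v 1) u)
            * partialD l (partialD k (fun v => F v 1)) u) / F u 1 ^ 3
      - 3 * partialD l (fun v => F v 1) u *
         (-(partialD i (fun v => F v 0) u * partialD j (fun v => F v 1) u
            + partialD i (fun v => F v 1) u * partialD j (fun v => F v 0) u)
            * partialD k (fun v => F v 0) u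
          + (partialD i (fun v => F v 0) u * partialD j (fun v => F v 0) u
            - partialD i (fun v => F v 1) u * partialD j (fun v => F v 1) u)
            * partialD k (fun v => F v 1) u) / F u 1 ^ 4 := by
  have h0 := h.self_of_nhds
  have hy' : ∀ᶠ v in 𝓝 u, F v 1 ≠ 0 := (h0.coord 1).continuousAt.eventually_ne hy
  have e := (h.eventually_nhds.and hy').mono fun v hv =>
    christoffelFirst_pullMetric hv.1 hv.2 i j k
  rw [partialD_congr e]
  have hx (m : Fin 3) := (h0.coord m).hasFDerivAt_of_smooth
  have hxx (m : Fin 3) (a : Fin 2) := ((h0.coord m).partialD a).hasFDerivAt_of_smooth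
  have h3 (m : Fin 3) (a b : Fin 2) :=
    (((h0.coord m).partialD b).partialD a).hasFDerivAt_of_smooth
  have := (((((h3 0 i j).mul (hxx 0 k)).add ((h3 1 i j).mul (hxx 1 k))).mul
    ((hasDerivAt_inv (pow_ne_zero 2 hy)).comp_hasFDerivAt u ((hx 1).pow 2))).add
      ((h3 2 i j).mul (hxx 2 k))).add
    (((((((hxx 0 i).mul (hxx 1 j)).add ((hxx 1 i).mul (hxx 0 j))).neg).mul (hxx 0 k)).add
      ((((hxx 0 i).mul (hxx 0 j)).sub ((hxx 1 i).mul (hxx 1 j))).mul (hxx 1 k))).mul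
      ((hasDerivAt_inv (pow_ne_zero 3 hy)).comp_hasFDerivAt u ((hx 1).pow 3)))
  have e3 := this.fderiv
  have e4 := congrArg (fun l' => l' (coordVec l)) e3
  refine Eq.trans (Eq.trans ?_ e4) ?_
  · rfl
  · simp [partialD]
    field_simp
    ring

end Gauss

/-- The second fundamental form of a parametrized surface `F`, with respect to `N`. -/
def pullSecond (F : E 2 → E 3) (u : E 2) (N : E 3) (v w : E 2) : ℝ :=
  metricInner ambientMetric (F u) (fderiv ℝ (fderiv ℝ F) u v w
    + christoffelVec ambientMetric (F u) (fderiv ℝ F u v) (fderiv ℝ F u w)) N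

lemma eq_smul_coordVec_add (w : E 2) : w = w 0 • coordVec 0 + w 1 • coordVec 1 := by
  ext i
  fin_cases i <;> simp [coordVec]

/-- In a 3-dimensional inner product space, `⟨A, B⟩` is the sum of a tangential and a normal part;
here the normal part is expressed through determinants. -/
lemma tangential_eq_inner_sub_normal (y a0 a1 a2 b0 b1 b2 p0 p1 p2 q0 q1 q2 D : ℝ) (hy : y ≠ 0)
    (hD0 : D ≠ 0)
    (hD : D = ((p0 * p0 + p1 * p1) / y ^ 2 + p2 * p2) * ((q0 * q0 + q1 * q1) / y ^ 2 + q2 * q2)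
      - ((p0 * q0 + p1 * q1) / y ^ 2 + p2 * q2) * ((q0 * p0 + q1 * p1) / y ^ 2 + q2 * p2)) :
    (D⁻¹ * ((q0 * q0 + q1 * q1) / y ^ 2 + q2 * q2) * ((a0 * p0 + a1 * p1) / y ^ 2 + a2 * p2)
        * ((b0 * p0 + b1 * p1) / y ^ 2 + b2 * p2)
      + D⁻¹ * -((p0 * q0 + p1 * q1) / y ^ 2 + p2 * q2) * ((a0 * p0 + a1 * p1) / y ^ 2 + a2 * p2)
        * ((b0 * q0 + b1 * q1) / y ^ 2 + b2 * q2))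
      + (D⁻¹ * -((q0 * p0 + q1 * p1) / y ^ 2 + q2 * p2) * ((a0 * q0 + a1 * q1) / y ^ 2 + a2 * q2)
        * ((b0 * p0 + b1 * p1) / y ^ 2 + b2 * p2)
      + D⁻¹ * ((p0 * p0 + p1 * p1) / y ^ 2 + p2 * p2) * ((a0 * q0 + a1 * q1) / y ^ 2 + a2 * q2)
        * ((b0 * q0 + b1 * q1) / y ^ 2 + b2 * q2))
      = ((a0 * b0 + a1 * b1) / y ^ 2 + a2 * b2)
      - (a0 * (p1 * q2 - p2 * q1) + a1 * (p2 * q0 - p0 * q2) + a2 * (p0 * q1 - p1 * q0))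
        * (b0 * (p1 * q2 - p2 * q1) + b1 * (p2 * q0 - p0 * q2) + b2 * (p0 * q1 - p1 * q0))
        / (D * y ^ 4) := by
  -- After multiplication by the Gram determinant `D`, the formula for `D` is needed only here;
  -- later `D` is just a nonzero symbol.
  have h1 : D * ((a0 * b0 + a1 * b1) / y ^ 2 + a2 * b2) =
      ((q0 * q0 + q1 * q1) / y ^ 2 + q2 * q2) * ((a0 * p0 + a1 * p1) / y ^ 2 + a2 * p2)
        * ((b0 * p0 + b1 * p1) / y ^ 2 + b2 * p2)
      - ((p0 * q0 + p1 * q1) / y ^ 2 + p2 * q2) * (((a0 * p0 + a1 * p1) / y ^ 2 + a2 * p2)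
        * ((b0 * q0 + b1 * q1) / y ^ 2 + b2 * q2) + ((a0 * q0 + a1 * q1) / y ^ 2 + a2 * q2)
        * ((b0 * p0 + b1 * p1) / y ^ 2 + b2 * p2))
      + ((p0 * p0 + p1 * p1) / y ^ 2 + p2 * p2) * ((a0 * q0 + a1 * q1) / y ^ 2 + a2 * q2)
        * ((b0 * q0 + b1 * q1) / y ^ 2 + b2 * q2)
      + (a0 * (p1 * q2 - p2 * q1) + a1 * (p2 * q0 - p0 * q2) + a2 * (p0 * q1 - p1 * q0))
        * (b0 * (p1 * q2 - p2 * q1) + b1 * (p2 * q0 - p0 * q2) + b2 * (p0 * q1 - p1 * q0))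
        / y ^ 4 := by
    rw [hD]
    field_simp
    ring
  clear hD
  have e : ((a0 * b0 + a1 * b1) / y ^ 2 + a2 * b2)
      = D⁻¹ * (D * ((a0 * b0 + a1 * b1) / y ^ 2 + a2 * b2)) := by field_simp
  rw [e, h1]
  field_simp
  ring

section Gauss

variable {F : E 2 → E 3} {u : E 2}

lemma pullSecond_coordVec (h : SmoothNear F u) (hy : F u 1 ≠ 0) (N : E 3) (i j : Fin 2) :
    pullSecond F u N (coordVec i) (coordVec j) =
      ((partialD i (partialD j (fun v => F v 0)) u
          - (partialD i (fun v => F v 0) u * partialD j (fun v => F v 1) u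
            + partialD i (fun v => F v 1) u * partialD j (fun v => F v 0) u) / F u 1) * N 0
        + (partialD i (partialD j (fun v => F v 1)) u
          + (partialD i (fun v => F v 0) u * partialD j (fun v => F v 0) u
            - partialD i (fun v => F v 1) u * partialD j (fun v => F v 1) u) / F u 1) * N 1)
          / F u 1 ^ 2
        + partialD i (partialD j (fun v => F v 2)) u * N 2 := by
  have h0 := h.self_of_nhds
  have hd := h0.differentiableAt (by simp)
  have e (m : Fin 3) : partialD i (partialD j (fun v => F v m)) u
      = fderiv ℝ (fderiv ℝ F) u (coordVec i) (coordVec j) m := by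
    rw [partialD_partialD (h0.coord m), fderiv_fderiv_coord h]
  have e' (m : Fin 3) (i : Fin 2) : partialD i (fun v => F v m) u
      = fderiv ℝ F u (coordVec i) m := by
    rw [fderiv_coord hd]; rfl
  rw [pullSecond, metricInner_ambient, christoffelVec_ambient _ _ _ hy]
  simp only [e, e']
  simp
  ring

/-- An immersed surface with vanishing intrinsic and extrinsic curvature has a degenerate
horizontal projection. -/
lemma horizontal_minor_eq_zero (h : SmoothNear F u) (hy : F u 1 ≠ 0)
    (hinj : Function.Injective (fderiv ℝ F u)) (hK : gaussOfMetric (pullMetric F) u = 0)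
    (hext : ∀ N, metricInner ambientMetric (F u) N N = 1 →
      (∀ v, metricInner ambientMetric (F u) (fderiv ℝ F u v) N = 0) →
      pullSecond F u N (coordVec 0) (coordVec 0) * pullSecond F u N (coordVec 1) (coordVec 1)
        - pullSecond F u N (coordVec 0) (coordVec 1)
          * pullSecond F u N (coordVec 1) (coordVec 0) = 0) (v w : E 2) :
    fderiv ℝ F u v 0 * fderiv ℝ F u w 1 = fderiv ℝ F u v 1 * fderiv ℝ F u w 0 := by
  have h0 := h.self_of_nhds
  have hd := h0.differentiableAt (by simp)
  have e' (m : Fin 3) (i : Fin 2) : partialD i (fun v => F v m) u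
      = fderiv ℝ F u (coordVec i) m := by
    rw [fderiv_coord hd]; rfl
  have hG0 := pullMetric_apply h0
  have hS := pullSecond_coordVec h hy
  have hC := christoffelFirst_pullMetric h hy
  have hD := partialD_christoffelFirst_pullMetric h hy
  have c (m : Fin 3) := partialD_comm (h0.coord m)
  have c3 (m : Fin 3) : partialD 0 (partialD 1 (partialD 1 (fun v => F v m))) u
      = partialD 1 (partialD 0 (partialD 1 (fun v => F v m))) u :=
    partialD_comm ((h0.coord m).partialD 1) 0 1
  simp only [e'] at hG0 hS hC hD
  have hab : ∀ v m, fderiv ℝ F u v m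
      = v 0 * fderiv ℝ F u (coordVec 0) m + v 1 * fderiv ℝ F u (coordVec 1) m := by
    intro v m
    conv_lhs => rw [eq_smul_coordVec_add v]
    simp
  have hinj' : ∀ v, (∀ m, fderiv ℝ F u v m = 0) → v = 0 := by
    intro v hv
    apply hinj
    rw [map_zero]
    ext m
    exact hv m
  set p := fderiv ℝ F u (coordVec 0) with hp
  set q := fderiv ℝ F u (coordVec 1) with hq
  clear_value p q
  set y := F u 1 with hyy
  clear_value y
  -- the Euclidean cross product of the two coordinate tangent vectors
  set n0 := p 1 * q 2 - p 2 * q 1 with hn0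
  set n1 := p 2 * q 0 - p 0 * q 2 with hn1
  set n2 := p 0 * q 1 - p 1 * q 0 with hn2
  have hn : 0 < n0 ^ 2 + n1 ^ 2 + n2 ^ 2 := by
    by_contra hcon
    have z0 : n0 = 0 := by nlinarith [sq_nonneg n0, sq_nonneg n1, sq_nonneg n2]
    have z1 : n1 = 0 := by nlinarith [sq_nonneg n0, sq_nonneg n1, sq_nonneg n2]
    have z2 : n2 = 0 := by nlinarith [sq_nonneg n0, sq_nonneg n1, sq_nonneg n2]
    -- A zero cross product makes `p` and `q` proportional, so these combinations lie in the kernel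
    -- of the injective differential.
    have hz : ∀ m, (q m) • coordVec 0 - (p m) • coordVec 1 = (0 : E 2) := by
      intro m
      apply hinj'
      intro l
      rw [hab]
      simp only [coordVec]
      fin_cases m <;> fin_cases l <;> simp <;> linarith
    have hq0 : ∀ m, q m = 0 := by
      intro m
      have := congrArg (fun v : E 2 => v 0) (hz m)
      simpa [coordVec] using this
    have : (coordVec 1 : E 2) = 0 := by
      apply hinj'
      intro m
      rw [← hq, hq0]
    have := congrArg (fun v : E 2 => v 1) this
    simp [coordVec] at this
  -- The cross product is a conormal; raising its index with the inverse metric gives the normal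
  -- `(y² n0, y² n1, n2)`, whose squared length is `r`.
  set r := y ^ 2 * (n0 ^ 2 + n1 ^ 2) + n2 ^ 2 with hr
  have hr0 : 0 < r := by
    have : 0 < y ^ 2 := by positivity
    rcases (sq_nonneg n2).eq_or_lt with h2 | h2
    · have : 0 < n0 ^ 2 + n1 ^ 2 := by linarith
      positivity
    · positivity
  have hs := Real.sq_sqrt hr0.le
  have hs0 := Real.sqrt_pos.2 hr0
  set s := √r with hsdef
  clear_value s
  have hext' := hext !₂[y ^ 2 * n0 / s, y ^ 2 * n1 / s, n2 / s] (by
      simp [metricInner_ambient, ← hyy]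
      field_simp
      linarith) (by
      intro v
      simp [metricInner_ambient, ← hyy, hab v, hn0, hn1, hn2]
      field_simp
      ring)
  simp only [hS] at hext'
  simp only [Matrix.cons_val_zero, Matrix.cons_val_one, Matrix.cons_val] at hext'
  have h00 := hG0 0 0
  have h01 := hG0 0 1
  have h10 := hG0 1 0
  have h11 := hG0 1 1
  rw [← hp] at h00
  rw [← hp, ← hq] at h01 h10
  rw [← hq] at h11
  have hdet : (pullMetric F u).det = r / y ^ 4 := by
    rw [Matrix.det_fin_two, h00, h01, h10, h11, hr, hn0, hn1, hn2]
    field_simp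
    ring
  have hdet0 : (pullMetric F u).det ≠ 0 := by
    rw [hdet]
    positivity
  have hR : riemann (pullMetric F) 0 1 1 0 u = 0 := (div_eq_zero_iff.1 hK).resolve_right hdet0
  -- `A0`, `A1`, `A2` are the components of the ambient covariant derivative `∇ᵢ ∂ⱼF`.
  let A0 (i j : Fin 2) : ℝ := partialD i (partialD j (fun v => F v 0)) u
    - (fderiv ℝ F u (coordVec i) 0 * fderiv ℝ F u (coordVec j) 1
      + fderiv ℝ F u (coordVec i) 1 * fderiv ℝ F u (coordVec j) 0) / y
  let A1 (i j : Fin 2) : ℝ := partialD i (partialD j (fun v => F v 1)) u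
    + (fderiv ℝ F u (coordVec i) 0 * fderiv ℝ F u (coordVec j) 0
      - fderiv ℝ F u (coordVec i) 1 * fderiv ℝ F u (coordVec j) 1) / y
  let A2 (i j : Fin 2) : ℝ := partialD i (partialD j (fun v => F v 2)) u
  have hC' : ∀ i j k, christoffelFirst (pullMetric F) i j k u
      = (A0 i j * fderiv ℝ F u (coordVec k) 0 + A1 i j * fderiv ℝ F u (coordVec k) 1) / y ^ 2
        + A2 i j * fderiv ℝ F u (coordVec k) 2 := by
    intro i j k
    rw [hC]
    simp only [A0, A1, A2]
    field_simp
    ring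
  -- The quadratic Christoffel terms are inner products of tangential parts, that is, full inner
  -- products minus products of normal parts.
  have key : ∀ i j k l, ∑ a, ∑ b, (pullMetric F u)⁻¹ a b
      * christoffelFirst (pullMetric F) i j a u * christoffelFirst (pullMetric F) k l b u
      = ((A0 i j * A0 k l + A1 i j * A1 k l) / y ^ 2 + A2 i j * A2 k l)
        - (A0 i j * n0 + A1 i j * n1 + A2 i j * n2) * (A0 k l * n0 + A1 k l * n1 + A2 k l * n2)
          / ((pullMetric F u).det * y ^ 4) := by
    intro i j k l
    have hd2 := Matrix.det_fin_two (pullMetric F u)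
    rw [h00, h01, h10, h11] at hd2
    rw [← tangential_eq_inner_sub_normal _ _ _ _ _ _ _ _ _ _ _ _ _ _ hy hdet0 hd2]
    rw [Matrix.inv_def, Ring.inverse_eq_inv', Matrix.adjugate_fin_two]
    simp only [Fin.sum_univ_two, hC', Matrix.smul_apply, Matrix.of_apply, Matrix.cons_val',
      Matrix.cons_val_zero, Matrix.cons_val_one, Matrix.cons_val_fin_one, smul_eq_mul, h00, h01,
      h10, h11, ← hp, ← hq]
  -- Vanishing extrinsic curvature cancels the normal contributions to `riemann`.
  have hnn : (A0 1 1 * n0 + A1 1 1 * n1 + A2 1 1 * n2) * (A0 0 0 * n0 + A1 0 0 * n1 + A2 0 0 * n2)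
      = (A0 0 1 * n0 + A1 0 1 * n1 + A2 0 1 * n2)
        * (A0 1 0 * n0 + A1 1 0 * n1 + A2 1 0 * n2) := by
    have e (i j : Fin 2) : (A0 i j * (y ^ 2 * n0 / s) + A1 i j * (y ^ 2 * n1 / s)) / y ^ 2
        + A2 i j * (n2 / s) = (A0 i j * n0 + A1 i j * n1 + A2 i j * n2) / s := by
      field_simp
    let W (i j : Fin 2) : ℝ := A0 i j * n0 + A1 i j * n1 + A2 i j * n2
    have h2 : W 0 0 / s * (W 1 1 / s) - W 0 1 / s * (W 1 0 / s) = 0 := by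
      simp only [W, ← e]
      exact hext'
    have h3 : (W 1 1 * W 0 0 - W 0 1 * W 1 0) / s ^ 2 = 0 := by
      rw [← h2]
      ring
    exact sub_eq_zero.1 ((div_eq_zero_iff.1 h3).resolve_right (by positivity))
  rw [riemann, key, key, hnn, hD, hD, c3, c3, c3] at hR
  have h10' (m : Fin 3) := c m 1 0
  simp only [A0, A1, A2, h10', ← hp, ← hq] at hR
  have hn2z : n2 ^ 2 = 0 := by
    clear_value n0 n1
    field_simp at hR
    -- Third derivatives cancel by symmetry; what is left of `riemann` is the ambient curvature
    -- term, a nonzero multiple of `n2²`.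
    have h2 : (y ^ 2 * (pullMetric F u).det) * n2 ^ 2 = 0 := by
      rw [hn2]
      linear_combination -hR
    exact (mul_eq_zero.1 h2).resolve_left (by positivity)
  have : n2 = 0 := by simpa using hn2z
  rw [hab, hab, hab, hab]
  rw [hn2] at this
  linear_combination (v 0 * w 1 - v 1 * w 0) * this

end Gauss

/-! ### Vertical tangent planes of the immersed surface -/

section Surface

variable {M : Type*} [TopologicalSpace M] [ChartedSpace (E 2) M] {f : M → UpperHalfPlane × ℝ}

lemma localParam_basePt (p : M) : localParam f p (basePt p) = coords (f p) := by
  rw [localParam, basePt, extChartAt_to_inv]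

lemma coords_im_pos (q : UpperHalfPlane × ℝ) : 0 < coords q 1 := q.1.im_pos

lemma basePt_mem_target (p : M) : basePt p ∈ (extChartAt (𝓡 2) p).target :=
  mem_extChartAt_target p

lemma secondForm_eq_pullSecond (p : M) (N : E 3) (v w : E 2) :
    secondForm f p N v w = pullSecond (localParam f p) (basePt p) N v w := by
  rw [pullSecond, localParam_basePt]
  rfl

/-- The matrix of the first fundamental form is invertible. -/
lemma det_firstForm_ne_zero (hf : IsSmoothImmersion f) (p : M) :
    (Matrix.of fun i j => firstForm f p (coordVec i) (coordVec j)).det ≠ 0 := by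
  intro h0
  obtain ⟨v, hv, hv0⟩ := Matrix.exists_mulVec_eq_zero_iff.2 h0
  have e : ∀ w m, diff f p w m
      = w 0 * diff f p (coordVec 0) m + w 1 * diff f p (coordVec 1) m := by
    intro w m
    conv_lhs => rw [eq_smul_coordVec_add w]
    simp
  have a0 := congrFun hv0 0
  have a1 := congrFun hv0 1
  have hy := coords_im_pos (f p)
  -- A kernel vector of the Gram matrix has an image of length zero.
  have hz : (diff f p (WithLp.toLp 2 v) 0 ^ 2 + diff f p (WithLp.toLp 2 v) 1 ^ 2)
        / coords (f p) 1 ^ 2 + diff f p (WithLp.toLp 2 v) 2 ^ 2 = 0 := by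
    simp only [e (WithLp.toLp 2 v)]
    simp only [Matrix.mulVec, dotProduct, Fin.sum_univ_two, Matrix.of_apply, firstForm,
      metricInner_ambient, Pi.zero_apply] at a0 a1
    linear_combination v 0 * a0 + v 1 * a1
  have hz0 : diff f p (WithLp.toLp 2 v) = 0 := by
    have h2 : 0 ≤ diff f p (WithLp.toLp 2 v) 2 ^ 2 := sq_nonneg _
    have h3 : (diff f p (WithLp.toLp 2 v) 0 ^ 2 + diff f p (WithLp.toLp 2 v) 1 ^ 2)
        / coords (f p) 1 ^ 2 = 0 := le_antisymm (by linarith) (by positivity)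
    have h4 := (div_eq_zero_iff.1 h3).resolve_right (by positivity)
    have z0 : diff f p (WithLp.toLp 2 v) 0 = 0 :=
      pow_eq_zero_iff two_ne_zero |>.1 (le_antisymm
        (by linarith [sq_nonneg (diff f p (WithLp.toLp 2 v) 1)]) (sq_nonneg _))
    have z1 : diff f p (WithLp.toLp 2 v) 1 = 0 :=
      pow_eq_zero_iff two_ne_zero |>.1 (le_antisymm
        (by linarith [sq_nonneg (diff f p (WithLp.toLp 2 v) 0)]) (sq_nonneg _))
    have z2 : diff f p (WithLp.toLp 2 v) 2 = 0 :=
      pow_eq_zero_iff two_ne_zero |>.1 (by linarith)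
    ext m
    fin_cases m
    exacts [z0, z1, z2]
  have := hf.2 p (hz0.trans (map_zero _).symm)
  apply hv
  ext m
  exact congrArg (fun w : E 2 => w m) this

variable [IsManifold (𝓡 2) ∞ M]

lemma contDiffOn_localParam (hf : IsSmoothImmersion f) (p : M) :
    ContDiffOn ℝ ∞ (localParam f p) (extChartAt (𝓡 2) p).target := by
  rw [← contMDiffOn_iff_contDiffOn]
  exact hf.1.comp_contMDiffOn (contMDiffOn_extChartAt_symm p)

lemma contDiffAt_localParam (hf : IsSmoothImmersion f) (p : M) {u : E 2}
    (hu : u ∈ (extChartAt (𝓡 2) p).target) : ContDiffAt ℝ ∞ (localParam f p) u :=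
  (contDiffOn_localParam hf p).contDiffAt ((isOpen_extChartAt_target p).mem_nhds hu)

lemma smoothNear_localParam (hf : IsSmoothImmersion f) (p : M) {u : E 2}
    (hu : u ∈ (extChartAt (𝓡 2) p).target) : SmoothNear (localParam f p) u := by
  filter_upwards [(isOpen_extChartAt_target p).mem_nhds hu] with v hv
  exact contDiffAt_localParam hf p hv

/-- Gauss equation: the tangent planes of a surface with vanishing curvatures are vertical. -/
lemma diff_horizontal_minor (hf : IsSmoothImmersion f) (hK : ∀ p, gaussianCurvature f p = 0)
    (hKext : ∀ p N, IsUnitNormal f p N → extrinsicCurvature f p N = 0) (p : M) (v w : E 2) :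
    diff f p v 0 * diff f p w 1 = diff f p v 1 * diff f p w 0 := by
  refine horizontal_minor_eq_zero (smoothNear_localParam hf p (basePt_mem_target p)) ?_
    (hf.2 p) (hK p) ?_ v w
  · rw [localParam_basePt]
    exact (coords_im_pos _).ne'
  · intro N hN1 hN2
    rw [localParam_basePt] at hN1 hN2
    have h := hKext p N ⟨hN1, hN2⟩
    rw [extrinsicCurvature, shapeMatrix, Matrix.det_mul, Matrix.det_nonsing_inv] at h
    have := (mul_eq_zero.1 h).resolve_left
      (by simpa using det_firstForm_ne_zero hf p)
    rw [Matrix.det_fin_two] at this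
    simpa only [Matrix.of_apply, secondForm_eq_pullSecond] using this

/-- The differential at `u` of the parametrization by the chart at `p` factors through the
differential at the corresponding point of the surface. -/
lemma exists_fderiv_localParam_eq (hf : IsSmoothImmersion f) (p : M) {u : E 2}
    (hu : u ∈ (extChartAt (𝓡 2) p).target) :
    ∃ D : E 2 →L[ℝ] E 2, fderiv ℝ (localParam f p) u
      = (diff f ((extChartAt (𝓡 2) p).symm u)).comp D := by
  set q := (extChartAt (𝓡 2) p).symm u with hq
  have hs : ContMDiffAt 𝓘(ℝ, E 2) (𝓡 2) ∞ (extChartAt (𝓡 2) p).symm u :=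
    (contMDiffOn_extChartAt_symm p).contMDiffAt ((isOpen_extChartAt_target p).mem_nhds hu)
  have hτ : ContMDiffAt 𝓘(ℝ, E 2) 𝓘(ℝ, E 2) ∞
      (fun u' => extChartAt (𝓡 2) q ((extChartAt (𝓡 2) p).symm u')) u :=
    (contMDiffAt_extChartAt (I := 𝓡 2) (n := ∞) (x := q)).comp u hs
  have hτd := (contMDiffAt_iff_contDiffAt.1 hτ).differentiableAt (by simp)
  -- The factor is the differential of the chart transition.
  refine ⟨fderiv ℝ (fun u' => extChartAt (𝓡 2) q ((extChartAt (𝓡 2) p).symm u')) u, ?_⟩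
  have he : localParam f p =ᶠ[𝓝 u] localParam f q ∘
      (fun u' => extChartAt (𝓡 2) q ((extChartAt (𝓡 2) p).symm u')) := by
    filter_upwards [hs.continuousAt.preimage_mem_nhds (extChartAt_source_mem_nhds (I := 𝓡 2) q)]
      with u' hu'
    simp only [Function.comp, localParam]
    rw [(extChartAt (𝓡 2) q).left_inv hu']
  rw [he.fderiv_eq, diff]
  exact fderiv_comp u ((contDiffAt_localParam hf q (basePt_mem_target q)).differentiableAt
    (by simp)) hτd

end Surface

/-! ### Local cylinder structure -/

/-- A surface whose horizontal projection is degenerate is locally a vertical cylinder over a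
curve, which is parametrized by one of its coordinates. -/
lemma exists_cylinder {F : E 2 → E 3} {u₀ : E 2} (h : SmoothNear F u₀)
    (hinj : Function.Injective (fderiv ℝ F u₀))
    (hJ : ∀ᶠ u in 𝓝 u₀, ∀ v w,
      fderiv ℝ F u v 0 * fderiv ℝ F u w 1 = fderiv ℝ F u v 1 * fderiv ℝ F u w 0) :
    ∃ i : Fin 3, i ≠ 2 ∧ ∃ β : ℝ → E 3, (∀ σ, β σ 2 = 0) ∧
      ∀ᶠ u in 𝓝 u₀, ContDiffAt ℝ 3 β (F u i) ∧ F u = β (F u i) + F u 2 • coordVec 2 := by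
  have h0 := h.self_of_nhds
  have hJ' : ∀ᶠ u in 𝓝 u₀, ∀ i k : Fin 3, i ≠ 2 → k ≠ 2 → ∀ v w,
      fderiv ℝ F u v i * fderiv ℝ F u w k = fderiv ℝ F u v k * fderiv ℝ F u w i := by
    filter_upwards [hJ] with u hu i k hi hk v w
    have := hu v w
    fin_cases i <;> fin_cases k <;> simp at hi hk ⊢ <;> linarith
  have hJ0 := hJ'.self_of_nhds
  -- a horizontal coordinate with nonzero differential
  obtain ⟨i, hi, v₀, hv₀⟩ : ∃ i : Fin 3, i ≠ 2 ∧ ∃ v, fderiv ℝ F u₀ v i ≠ 0 := by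
    by_contra! hcon
    set d := fderiv ℝ F u₀ with hd
    have hz : (d (coordVec 1) 2) • coordVec 0 - (d (coordVec 0) 2) • coordVec 1 = (0 : E 2) := by
      apply hinj
      rw [map_zero]
      ext m
      by_cases hm : m = 2
      · subst hm
        simp
        ring
      · exact hcon m hm _
    have h2 : d (coordVec 1) 2 = 0 := by
      simpa [coordVec] using congrArg (fun v : E 2 => v 0) hz
    have h3 : (coordVec 1 : E 2) = 0 := by
      apply hinj
      rw [map_zero]
      ext m
      by_cases hm : m = 2
      · subst hm; exact h2
      · exact hcon m hm _
    have := congrArg (fun v : E 2 => v 1) h3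
    simp [coordVec] at this
  refine ⟨i, hi, ?_⟩
  set π : E 3 →L[ℝ] ℝ × ℝ := (EuclideanSpace.proj (𝕜 := ℝ) i).prod (EuclideanSpace.proj 2) with hπ
  -- If the `i`-th and vertical components of `dF w` vanish, the vanishing minor against `v₀` kills
  -- the remaining one; so `(F i, F 2)` are local coordinates.
  have hLinj : Function.Injective (π.comp (fderiv ℝ F u₀)).toLinearMap := by
    rw [← LinearMap.ker_eq_bot, LinearMap.ker_eq_bot']
    intro w hw
    have h1 : fderiv ℝ F u₀ w i = 0 := congrArg Prod.fst hw
    have h2 : fderiv ℝ F u₀ w 2 = 0 := congrArg Prod.snd hw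
    apply hinj
    rw [map_zero]
    ext k
    by_cases hk : k = 2
    · subst hk; exact h2
    · have := hJ0 i k hi hk v₀ w
      rw [h1, mul_zero] at this
      exact (mul_eq_zero.1 this).resolve_left hv₀
  have hLsurj := (LinearMap.injective_iff_surjective_of_finrank_eq_finrank (by simp)).1 hLinj
  let L : E 2 ≃L[ℝ] ℝ × ℝ :=
    (LinearEquiv.ofBijective (π.comp (fderiv ℝ F u₀)).toLinearMap
      ⟨hLinj, hLsurj⟩).toContinuousLinearEquiv
  -- Order `3` lets the curvature of `β` be differentiated once; being finite, it persists on a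
  -- neighbourhood.
  have hψ : ContDiffAt ℝ 3 (fun u => π (F u)) u₀ :=
    π.contDiff.contDiffAt.comp u₀ (h0.of_le ENat.LEInfty.out)
  have hψ' : HasFDerivAt (fun u => π (F u)) (L : E 2 →L[ℝ] ℝ × ℝ) u₀ :=
    π.hasFDerivAt.comp u₀ (h0.differentiableAt (by simp)).hasFDerivAt
  have hst := hψ.hasStrictFDerivAt' hψ' (by simp)
  set θ := hψ.localInverse hψ' (by simp) with hθdef
  have hθ : ContDiffAt ℝ 3 θ (π (F u₀)) := hψ.to_localInverse hψ' (by simp)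
  have hleft : ∀ᶠ u in 𝓝 u₀, θ (π (F u)) = u := hst.eventually_left_inverse
  have hright : ∀ᶠ z in 𝓝 (π (F u₀)), π (F (θ z)) = z := hst.eventually_right_inverse
  have hθt : Tendsto θ (𝓝 (π (F u₀))) (𝓝 u₀) := hst.localInverse_tendsto
  obtain ⟨r, hr, hball⟩ := Metric.eventually_nhds_iff_ball.1
    (((hθ.eventually (by simp)).and hright.eventually_nhds).and (hθt.eventually (h.and hJ')))
  have hG : ∀ z ∈ Metric.ball (π (F u₀)) r, ContDiffAt ℝ 3 (fun z => F (θ z)) z := by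
    intro z hz
    exact ((hball z hz).2.1.of_le ENat.LEInfty.out).comp z (hball z hz).1.1
  have hcoord : ∀ z ∈ Metric.ball (π (F u₀)) r, F (θ z) i = z.1 ∧ F (θ z) 2 = z.2 := by
    intro z hz
    have := (hball z hz).1.2.self_of_nhds
    exact ⟨congrArg Prod.fst this, congrArg Prod.snd this⟩
  -- In the coordinates `(σ, t)`, the `i`-th components of `∂_σ F` and `∂ₜ F` are `1` and `0`; the
  -- vanishing minor then forces `∂ₜ F` to be vertical.
  have hvert : ∀ z ∈ Metric.ball (π (F u₀)) r, ∀ k : Fin 3, k ≠ 2 →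
      fderiv ℝ (fun z => F (θ z)) z (0, 1) k = 0 := by
    intro z hz k hk
    obtain ⟨⟨hz1, hz2⟩, hz3, hz4⟩ := hball z hz
    have hF := (hz3.differentiableAt (by simp)).hasFDerivAt
    have hθd := (hz1.differentiableAt (by simp)).hasFDerivAt
    have hc := hF.comp z hθd
    have hid : (π.comp ((fderiv ℝ F (θ z)).comp (fderiv ℝ θ z))) = ContinuousLinearMap.id ℝ _ := by
      have e1 := (π.hasFDerivAt.comp z hc).fderiv
      rw [← e1]
      have e2 : (π ∘ F ∘ θ) =ᶠ[𝓝 z] id := hz2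
      rw [e2.fderiv_eq, fderiv_id]
    have e3 := hz4 i k hi hk (fderiv ℝ θ z (1, 0)) (fderiv ℝ θ z (0, 1))
    have e4 : fderiv ℝ F (θ z) (fderiv ℝ θ z (1, 0)) i = 1 :=
      congrArg (fun l => (l ((1 : ℝ), (0 : ℝ))).1) hid
    have e5 : fderiv ℝ F (θ z) (fderiv ℝ θ z (0, 1)) i = 0 :=
      congrArg (fun l => (l ((0 : ℝ), (1 : ℝ))).1) hid
    rw [e4, e5] at e3
    change fderiv ℝ (F ∘ θ) z (0, 1) k = 0
    rw [hc.fderiv]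
    simpa using e3
  set σ₀ := F u₀ i
  set t₀ := F u₀ 2
  have hz0 : π (F u₀) = (σ₀, t₀) := rfl
  rw [hz0] at hball hG hcoord hvert hθ hright hθt
  have hmem : ∀ σ t, (σ, t) ∈ Metric.ball (σ₀, t₀) r
      ↔ σ ∈ Metric.ball σ₀ r ∧ t ∈ Metric.ball t₀ r := by
    intro σ t
    rw [← ball_prod_same]
    rfl
  have hconst : ∀ σ t, (σ, t) ∈ Metric.ball (σ₀, t₀) r → ∀ k : Fin 3, k ≠ 2 →
      F (θ (σ, t)) k = F (θ (σ, t₀)) k := by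
    intro σ t hσt k hk
    have hd : ∀ t' ∈ Metric.ball t₀ r, HasDerivAt (fun t' => F (θ (σ, t')) k) 0 t' := by
      intro t' ht'
      have hm := (hmem σ t').2 ⟨((hmem σ t).1 hσt).1, ht'⟩
      have d1 := ((hG _ hm).differentiableAt (by simp)).hasFDerivAt
      have d2 : HasDerivAt (fun t' : ℝ => (σ, t')) (0, 1) t' :=
        (hasDerivAt_const t' σ).prodMk (hasDerivAt_id t')
      have d3 := (hasFDerivAt_coord k _).comp_hasDerivAt t' (d1.comp_hasDerivAt t' d2)
      refine d3.congr_deriv ?_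
      exact hvert _ hm k hk
    exact Metric.isOpen_ball.is_const_of_deriv_eq_zero
      (convex_ball t₀ r).isPreconnected
      (fun t' ht' => (hd t' ht').differentiableAt.differentiableWithinAt)
      (fun t' ht' => (hd t' ht').deriv) ((hmem σ t).1 hσt).2 (Metric.mem_ball_self hr)
  -- The profile is the slice at height `t₀`, projected to the horizontal plane.
  refine ⟨fun σ => F (θ (σ, t₀)) - F (θ (σ, t₀)) 2 • coordVec 2, by simp [coordVec], ?_⟩
  have hψc : Tendsto (fun u => π (F u)) (𝓝 u₀) (𝓝 (σ₀, t₀)) := hψ.continuousAt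
  filter_upwards [hleft, hψc.eventually (Metric.ball_mem_nhds _ hr)] with u hu1 hu2
  have hπu : π (F u) = (F u i, F u 2) := rfl
  have hm : (F u i, t₀) ∈ Metric.ball (σ₀, t₀) r :=
    (hmem _ _).2 ⟨((hmem _ _).1 hu2).1, Metric.mem_ball_self hr⟩
  constructor
  · have c1 : ContDiffAt ℝ 3 (fun σ => F (θ (σ, t₀))) (F u i) :=
      ContDiffAt.comp (g := fun z => F (θ z)) (f := fun σ => (σ, t₀)) (F u i)
        (hG _ hm) (contDiffAt_id.prodMk contDiffAt_const)
    exact c1.sub (((EuclideanSpace.proj (𝕜 := ℝ) (2 : Fin 3) : E 3 →L[ℝ] ℝ).smulRight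
      (coordVec 2)).contDiff.contDiffAt.comp _ c1)
  · ext k
    by_cases hk : k = 2
    · subst hk
      simp [coordVec]
    · have := hconst (F u i) (F u 2) hu2 k hk
      rw [← hπu, hu1] at this
      simp [coordVec, hk, this]

/-! ### Geometry of a vertical cylinder -/

section Surface

variable {M : Type*} [TopologicalSpace M] {f : M → UpperHalfPlane × ℝ}

/-- Near `p` the surface is the vertical cylinder over the horizontal curve `β`, which is
parametrized by the `i`-th coordinate. -/
structure IsCylinderAt (f : M → UpperHalfPlane × ℝ) (p : M) (i : Fin 3) (β : ℝ → E 3) : Prop where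
  ne_two : i ≠ 2
  horizontal : ∀ σ, β σ 2 = 0
  contDiffAt : ContDiffAt ℝ 3 β (coords (f p) i)
  eventually_eq : ∀ᶠ q in 𝓝 p, coords (f q) = β (coords (f q) i) + coords (f q) 2 • coordVec 2

/-- The squared length of the velocity of the horizontal curve `β`. -/
def profileSpeed (β : ℝ → E 3) (σ : ℝ) : ℝ :=
  (deriv β σ 0 ^ 2 + deriv β σ 1 ^ 2) / β σ 1 ^ 2

/-- The component along `(n₀, n₁)` of the acceleration of the horizontal curve `β`. -/
def profileAccel (β : ℝ → E 3) (σ n₀ n₁ : ℝ) : ℝ :=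
  ((deriv (deriv β) σ 0 - 2 * deriv β σ 0 * deriv β σ 1 / β σ 1) * n₀
    + (deriv (deriv β) σ 1 + (deriv β σ 0 ^ 2 - deriv β σ 1 ^ 2) / β σ 1) * n₁) / β σ 1 ^ 2

/-- The component of the acceleration of `β` along its rotated velocity. -/
def profileCurv (β : ℝ → E 3) (σ : ℝ) : ℝ :=
  profileAccel β σ (-deriv β σ 1) (deriv β σ 0)

namespace IsCylinderAt

variable {p : M} {i : Fin 3} {β : ℝ → E 3}

lemma coords_one (hc : IsCylinderAt f p i β) : β (coords (f p) i) 1 = coords (f p) 1 := by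
  have := congrArg (fun x : E 3 => x 1) hc.eventually_eq.self_of_nhds
  simpa [coordVec] using this.symm

lemma im_pos (hc : IsCylinderAt f p i β) : 0 < β (coords (f p) i) 1 := by
  rw [hc.coords_one]
  exact coords_im_pos _

variable [ChartedSpace (E 2) M]

lemma localParam_eventuallyEq (hc : IsCylinderAt f p i β) :
    ∀ᶠ u in 𝓝 (basePt p), localParam f p u
      = β (localParam f p u i) + localParam f p u 2 • coordVec 2 := by
  have h := (continuousAt_extChartAt_symm (I := 𝓡 2) p).eventually
    ((extChartAt_to_inv (I := 𝓡 2) p).symm ▸ hc.eventually_eq)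
  exact h

variable [IsManifold (𝓡 2) ∞ M]

lemma fderiv_localParam (hf : IsSmoothImmersion f) (hc : IsCylinderAt f p i β) :
    ∀ᶠ u in 𝓝 (basePt p), ∀ v, fderiv ℝ (localParam f p) u v
      = fderiv ℝ (localParam f p) u v i • deriv β (localParam f p u i)
        + fderiv ℝ (localParam f p) u v 2 • coordVec 2 := by
  have hs := smoothNear_localParam hf p (basePt_mem_target p)
  have hcont : ContinuousAt (fun u => localParam f p u i) (basePt p) :=
    (hs.self_of_nhds.coord i).continuousAt
  have hβ := (hc.contDiffAt.eventually (by simp))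
  rw [← localParam_basePt p] at hβ
  filter_upwards [hs, (hc.localParam_eventuallyEq).eventually_nhds,
    hcont.eventually hβ] with u hu1 hu2 hu3 v
  have hd := hu1.differentiableAt (by simp)
  have hF (m : Fin 3) := (EuclideanSpace.proj (𝕜 := ℝ) m : E 3 →L[ℝ] ℝ).hasFDerivAt.comp u
    hd.hasFDerivAt
  have h1 := (((hu3.differentiableAt (by simp)).hasFDerivAt).comp u (hF i)).add
    ((hF 2).smul_const (coordVec 2))
  have h2 := h1.congr_of_eventuallyEq (f₁ := localParam f p) hu2
  conv_lhs => rw [h2.fderiv]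
  simp

lemma diff_eq (hf : IsSmoothImmersion f) (hc : IsCylinderAt f p i β) (v : E 2) :
    diff f p v = diff f p v i • deriv β (coords (f p) i) + diff f p v 2 • coordVec 2 := by
  have := (hc.fderiv_localParam hf).self_of_nhds v
  rwa [localParam_basePt] at this

lemma exists_diff_eq (hf : IsSmoothImmersion f) (hc : IsCylinderAt f p i β) (a b : ℝ) :
    ∃ v, diff f p v i = a ∧ diff f p v 2 = b := by
  set π : E 3 →L[ℝ] ℝ × ℝ := (EuclideanSpace.proj (𝕜 := ℝ) i).prod (EuclideanSpace.proj 2)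
  have hLinj : Function.Injective (π.comp (diff f p)).toLinearMap := by
    rw [← LinearMap.ker_eq_bot, LinearMap.ker_eq_bot']
    intro w hw
    have h1 : diff f p w i = 0 := congrArg Prod.fst hw
    have h2 : diff f p w 2 = 0 := congrArg Prod.snd hw
    apply hf.2 p
    rw [hc.diff_eq hf w, h1, h2]
    simp
  have hLsurj := (LinearMap.injective_iff_surjective_of_finrank_eq_finrank (by simp)).1 hLinj
  obtain ⟨v, hv⟩ := hLsurj (a, b)
  exact ⟨v, congrArg Prod.fst hv, congrArg Prod.snd hv⟩

/-- Differentiating the cylinder equation twice, the coefficients `a` and `b` may stay unspecified: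
they multiply tangent vectors, which pair to zero with a normal. -/
lemma sndDeriv_eq (hf : IsSmoothImmersion f) (hc : IsCylinderAt f p i β) (v w : E 2) :
    ∃ a b : ℝ, fderiv ℝ (fderiv ℝ (localParam f p)) (basePt p) v w
      = a • deriv β (coords (f p) i)
        + (diff f p v i * diff f p w i) • deriv (deriv β) (coords (f p) i)
        + b • coordVec 2 := by
  have hs := smoothNear_localParam hf p (basePt_mem_target p)
  have h0 := hs.self_of_nhds
  have hd2 : DifferentiableAt ℝ (fderiv ℝ (localParam f p)) (basePt p) :=
    (h0.fderiv_right (m := ∞) (by simp)).differentiableAt (by simp)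
  have hw := hd2.hasFDerivAt.clm_apply (hasFDerivAt_const w (basePt p))
  have hwm (m : Fin 3) := (EuclideanSpace.proj (𝕜 := ℝ) m : E 3 →L[ℝ] ℝ).hasFDerivAt.comp
    (basePt p) hw
  have hF := (EuclideanSpace.proj (𝕜 := ℝ) i : E 3 →L[ℝ] ℝ).hasFDerivAt.comp (basePt p)
    (h0.differentiableAt (by simp)).hasFDerivAt
  have hβ : DifferentiableAt ℝ (deriv β) (localParam f p (basePt p) i) := by
    rw [localParam_basePt]
    exact (hc.contDiffAt.derivWithin (m := 1) (by norm_num)).differentiableAt (by simp)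
  have h1 := ((hwm i).smul (hβ.hasFDerivAt.comp (basePt p) hF)).add
    ((hwm 2).smul_const (coordVec 2))
  have h2 := h1.congr_of_eventuallyEq (f₁ := fun u => fderiv ℝ (localParam f p) u w)
    ((hc.fderiv_localParam hf).mono fun u hu => hu w)
  have h3 := congrArg (fun l => l v) (hw.unique h2)
  simp [localParam_basePt] at h3
  exact ⟨_, _, h3.trans (by
    simp only [diff]
    module)⟩

/-- The profile curve is regular. -/
lemma deriv_ne_zero (hf : IsSmoothImmersion f) (hc : IsCylinderAt f p i β) :
    0 < deriv β (coords (f p) i) 0 ^ 2 + deriv β (coords (f p) i) 1 ^ 2 := by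
  -- Since `β` is parametrized by its `i`-th coordinate, the `i`-th component of `β'` is `1`.
  obtain ⟨v, hv1, hv2⟩ := hc.exists_diff_eq hf 1 0
  have h := congrArg (fun x : E 3 => x i) (hc.diff_eq hf v)
  rw [hv1, hv2] at h
  have hi := hc.ne_two
  fin_cases i
  · simp at h ⊢
    rw [← h]
    positivity
  · simp at h ⊢
    rw [← h]
    positivity
  · simp at hi

lemma speed_pos (hf : IsSmoothImmersion f) (hc : IsCylinderAt f p i β) :
    0 < profileSpeed β (coords (f p) i) := by
  have := hc.deriv_ne_zero hf
  have := hc.im_pos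
  rw [profileSpeed]
  positivity

lemma diff_zero (hf : IsSmoothImmersion f) (hc : IsCylinderAt f p i β) (v : E 2) :
    diff f p v 0 = diff f p v i * deriv β (coords (f p) i) 0 := by
  simpa [coordVec] using congrArg (fun x : E 3 => x 0) (hc.diff_eq hf v)

lemma diff_one (hf : IsSmoothImmersion f) (hc : IsCylinderAt f p i β) (v : E 2) :
    diff f p v 1 = diff f p v i * deriv β (coords (f p) i) 1 := by
  simpa [coordVec] using congrArg (fun x : E 3 => x 1) (hc.diff_eq hf v)

lemma isUnitNormal_iff (hf : IsSmoothImmersion f) (hc : IsCylinderAt f p i β) (N : E 3) :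
    IsUnitNormal f p N ↔ N 2 = 0 ∧
      deriv β (coords (f p) i) 0 * N 0 + deriv β (coords (f p) i) 1 * N 1 = 0 ∧
      N 0 ^ 2 + N 1 ^ 2 = β (coords (f p) i) 1 ^ 2 := by
  have hy := hc.im_pos
  simp only [IsUnitNormal, metricInner_ambient, hc.diff_zero hf, hc.diff_one hf,
    ← hc.coords_one]
  constructor
  · rintro ⟨h1, h2⟩
    obtain ⟨v, hv1, hv2⟩ := hc.exists_diff_eq hf 1 0
    obtain ⟨w, hw1, hw2⟩ := hc.exists_diff_eq hf 0 1
    have a1 := h2 v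
    have a2 := h2 w
    rw [hv1, hv2] at a1
    rw [hw1, hw2] at a2
    have hN2 : N 2 = 0 := by simpa using a2
    rw [hN2] at h1 a1
    field_simp at h1 a1
    exact ⟨hN2, by linarith, by linarith⟩
  · rintro ⟨h1, h2, h3⟩
    constructor
    · rw [h1]
      field_simp
      linarith
    · intro v
      rw [h1]
      field_simp
      linear_combination diff f p v i * h2

lemma firstForm_eq (hf : IsSmoothImmersion f) (hc : IsCylinderAt f p i β) (v w : E 2) :
    firstForm f p v w = diff f p v i * diff f p w i * profileSpeed β (coords (f p) i)
      + diff f p v 2 * diff f p w 2 := by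
  rw [firstForm, metricInner_ambient, hc.diff_zero hf, hc.diff_one hf, hc.diff_zero hf,
    hc.diff_one hf, profileSpeed, hc.coords_one]
  ring

lemma secondForm_eq (hf : IsSmoothImmersion f) (hc : IsCylinderAt f p i β) {N : E 3}
    (hN : IsUnitNormal f p N) (v w : E 2) :
    secondForm f p N v w = diff f p v i * diff f p w i
      * profileAccel β (coords (f p) i) (N 0) (N 1) := by
  have hy := hc.im_pos
  obtain ⟨hN2, hN1, -⟩ := (hc.isUnitNormal_iff hf N).1 hN
  obtain ⟨a, b, hab⟩ := hc.sndDeriv_eq hf v w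
  rw [secondForm, metricInner_ambient, christoffelVec_ambient _ _ _ (coords_im_pos _).ne', hab,
    hN2, hc.diff_zero hf, hc.diff_one hf, hc.diff_zero hf, hc.diff_one hf, profileAccel,
    ← hc.coords_one]
  simp [coordVec]
  field_simp
  linear_combination a * β (coords (f p) i) 1 * hN1

/-- In the coordinates `(σ, t)` the first form is `diag(B, 1)` and the second is `diag(A, 0)`, where
`B` is `profileSpeed` and `A` is `profileAccel` along `N`; half the trace is `A / (2B)`. -/
lemma meanCurvature_eq (hf : IsSmoothImmersion f) (hc : IsCylinderAt f p i β) {N : E 3}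
    (hN : IsUnitNormal f p N) :
    meanCurvature f p N = profileAccel β (coords (f p) i) (N 0) (N 1)
      / (2 * profileSpeed β (coords (f p) i)) := by
  have hB := hc.speed_pos hf
  have hdet := det_firstForm_ne_zero hf p
  rw [meanCurvature, shapeMatrix, Matrix.inv_def, Ring.inverse_eq_inv', Matrix.adjugate_fin_two]
  rw [Matrix.det_fin_two] at hdet ⊢
  simp only [Matrix.of_apply, Matrix.trace_fin_two, Matrix.smul_mul, Matrix.smul_apply,
    Matrix.mul_apply, Fin.sum_univ_two, hc.firstForm_eq hf, hc.secondForm_eq hf hN,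
    Matrix.cons_val', Matrix.cons_val_zero, Matrix.cons_val_one, Matrix.cons_val_fin_one,
    smul_eq_mul] at hdet ⊢
  generalize diff f p (coordVec 0) i = a₀ at hdet ⊢
  generalize diff f p (coordVec 1) i = a₁ at hdet ⊢
  generalize diff f p (coordVec 0) 2 = b₀ at hdet ⊢
  generalize diff f p (coordVec 1) 2 = b₁ at hdet ⊢
  generalize profileSpeed β (coords (f p) i) = B at hdet hB ⊢
  -- The Gram determinant is `B` times the squared Jacobian of the change to `(σ, t)`.
  have e : (a₀ * a₀ * B + b₀ * b₀) * (a₁ * a₁ * B + b₁ * b₁)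
      - (a₀ * a₁ * B + b₀ * b₁) * (a₁ * a₀ * B + b₁ * b₀) = B * (a₀ * b₁ - a₁ * b₀) ^ 2 := by ring
  rw [e] at hdet ⊢
  have h2 : a₀ * b₁ - a₁ * b₀ ≠ 0 := by
    intro h
    simp [h] at hdet
  field_simp
  ring

/-- A unit normal is plus or minus the rotated velocity of `β` divided by its length; squaring
removes the choice of sign. -/
lemma accel_sq (hf : IsSmoothImmersion f) (hc : IsCylinderAt f p i β) {N : E 3}
    (hN : IsUnitNormal f p N) :
    profileAccel β (coords (f p) i) (N 0) (N 1) ^ 2 * profileSpeed β (coords (f p) i)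
      = profileCurv β (coords (f p) i) ^ 2 := by
  obtain ⟨-, h1, h2⟩ := (hc.isUnitNormal_iff hf N).1 hN
  have hb := hc.deriv_ne_zero hf
  have hy := hc.im_pos
  rw [profileCurv, profileAccel, profileAccel, profileSpeed]
  set b₀ := deriv β (coords (f p) i) 0
  set b₁ := deriv β (coords (f p) i) 1
  have e0 : N 0 = -((b₀ * N 1 - b₁ * N 0) / (b₀ ^ 2 + b₁ ^ 2)) * b₁ := by
    field_simp
    linear_combination b₀ * h1
  have e1 : N 1 = ((b₀ * N 1 - b₁ * N 0) / (b₀ ^ 2 + b₁ ^ 2)) * b₀ := by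
    field_simp
    linear_combination b₁ * h1
  generalize (b₀ * N 1 - b₁ * N 0) / (b₀ ^ 2 + b₁ ^ 2) = l at e0 e1
  rw [e0, e1] at h2 ⊢
  generalize deriv (deriv β) (coords (f p) i) 0 - 2 * b₀ * b₁ / β (coords (f p) i) 1 = c₀
  generalize deriv (deriv β) (coords (f p) i) 1 + (b₀ ^ 2 - b₁ ^ 2) / β (coords (f p) i) 1 = c₁
  field_simp
  linear_combination (c₁ * b₀ - c₀ * b₁) ^ 2 * h2

lemma meanCurvature_sq (hf : IsSmoothImmersion f) (hc : IsCylinderAt f p i β) {N : E 3}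
    (hN : IsUnitNormal f p N) :
    meanCurvature f p N ^ 2 = profileCurv β (coords (f p) i) ^ 2
      / (4 * profileSpeed β (coords (f p) i) ^ 3) := by
  have hB := hc.speed_pos hf
  rw [hc.meanCurvature_eq hf hN, ← hc.accel_sq hf hN]
  field_simp
  ring

lemma exists_isUnitNormal (hf : IsSmoothImmersion f) (hc : IsCylinderAt f p i β) :
    ∃ N, IsUnitNormal f p N := by
  have hb := hc.deriv_ne_zero hf
  have hs := Real.sq_sqrt hb.le
  have hs0 := Real.sqrt_pos.2 hb
  set s := √(deriv β (coords (f p) i) 0 ^ 2 + deriv β (coords (f p) i) 1 ^ 2)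
  refine ⟨!₂[-(β (coords (f p) i) 1 / s * deriv β (coords (f p) i) 1),
    β (coords (f p) i) 1 / s * deriv β (coords (f p) i) 0, 0], (hc.isUnitNormal_iff hf _).2 ?_⟩
  simp only [Matrix.cons_val_zero, Matrix.cons_val_one, Matrix.cons_val]
  refine ⟨trivial, by ring, ?_⟩
  field_simp
  linear_combination -β (coords (f p) i) 1 ^ 2 * hs

/-- The horizontal direction carries the whole trace, because the vertical one has curvature zero.
-/
lemma isPrincipal (hf : IsSmoothImmersion f) (hc : IsCylinderAt f p i β) {N : E 3}
    (hN : IsUnitNormal f p N) : ∃ v, IsPrincipal f p N (2 * meanCurvature f p N) v := by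
  have hB := hc.speed_pos hf
  obtain ⟨v, hv1, hv2⟩ := hc.exists_diff_eq hf 1 0
  refine ⟨v, ?_, fun w => ?_⟩
  · rintro rfl
    simp at hv1
  · rw [hc.secondForm_eq hf hN, hc.firstForm_eq hf, hc.meanCurvature_eq hf hN, hv1, hv2]
    field_simp
    ring

/-- The normal witnessing planarity may differ from `N`; `H²` does not depend on that choice. -/
lemma meanCurvature_eq_zero_of_isPlanar (hf : IsSmoothImmersion f) (hc : IsCylinderAt f p i β)
    (hp : IsPlanar f p) {N : E 3} (hN : IsUnitNormal f p N) : meanCurvature f p N = 0 := by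
  obtain ⟨N', hN', h⟩ := hp
  obtain ⟨v, hv⟩ := hc.isPrincipal hf hN'
  have h0 : meanCurvature f p N' = 0 := by linarith [h _ _ hv]
  have := hc.meanCurvature_sq hf hN
  rw [← hc.meanCurvature_sq hf hN', h0] at this
  simpa using this

/-- If `H = 0`, the second form of the cylinder vanishes, so `k |v|² = 0` for the principal vector
`v` with `k ≠ 0`, which is impossible. -/
lemma meanCurvature_ne_zero_of_isParabolic (hf : IsSmoothImmersion f) (hc : IsCylinderAt f p i β)
    (hp : IsParabolic f p) {N : E 3} (hN : IsUnitNormal f p N) : meanCurvature f p N ≠ 0 := by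
  obtain ⟨N', hN', -, k, v, hk, hv0, hv⟩ := hp
  have hB := hc.speed_pos hf
  intro h0
  have h1 : meanCurvature f p N' = 0 := by
    have := hc.meanCurvature_sq hf hN'
    rw [← hc.meanCurvature_sq hf hN, h0] at this
    simpa using this
  rw [hc.meanCurvature_eq hf hN', div_eq_zero_iff] at h1
  have h2 := h1.resolve_right (by positivity)
  have h3 := hv v
  rw [hc.secondForm_eq hf hN', h2, mul_zero, hc.firstForm_eq hf] at h3
  have h4 := (mul_eq_zero.1 h3.symm).resolve_left hk
  have h5 : 0 ≤ diff f p v i * diff f p v i * profileSpeed β (coords (f p) i) :=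
    mul_nonneg (mul_self_nonneg _) hB.le
  have h6 : diff f p v 2 = 0 := mul_self_eq_zero.1 (by linarith [mul_self_nonneg (diff f p v 2)])
  have h7 : diff f p v i = 0 := by
    rw [h6, mul_zero, add_zero] at h4
    exact mul_self_eq_zero.1 ((mul_eq_zero.1 h4).resolve_right hB.ne')
  apply hv0
  apply hf.2 p
  rw [hc.diff_eq hf, h6, h7]
  simp

/-- Where the profile curve is not a geodesic, asymptotic directions are vertical. -/
lemma diff_mul_curv_eq_zero (hf : IsSmoothImmersion f) (hc : IsCylinderAt f p i β) {v : E 2}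
    (hv : IsAsymptoticDir f p v) : diff f p v i * profileCurv β (coords (f p) i) = 0 := by
  obtain ⟨N, hN, -, h⟩ := hv
  obtain ⟨w, hw1, -⟩ := hc.exists_diff_eq hf 1 0
  have h1 := h w
  rw [hc.secondForm_eq hf hN, hw1, zero_mul, mul_one] at h1
  rcases mul_eq_zero.1 h1 with h2 | h2
  · rw [h2, zero_mul]
  · have := hc.accel_sq hf hN
    rw [h2] at this
    have h3 : profileCurv β (coords (f p) i) = 0 := by simpa using this.symm
    rw [h3, mul_zero]

end IsCylinderAt

variable [ChartedSpace (E 2) M] [IsManifold (𝓡 2) ∞ M]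

/-- A surface with vanishing intrinsic and extrinsic curvature is locally a vertical cylinder. -/
lemma exists_isCylinderAt (hf : IsSmoothImmersion f) (hK : ∀ p, gaussianCurvature f p = 0)
    (hKext : ∀ p N, IsUnitNormal f p N → extrinsicCurvature f p N = 0) (p : M) :
    ∃ i β, ∀ᶠ q in 𝓝 p, IsCylinderAt f q i β := by
  have hJ : ∀ᶠ u in 𝓝 (basePt p), ∀ v w, fderiv ℝ (localParam f p) u v 0
      * fderiv ℝ (localParam f p) u w 1 = fderiv ℝ (localParam f p) u v 1
      * fderiv ℝ (localParam f p) u w 0 := by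
    filter_upwards [(isOpen_extChartAt_target p).mem_nhds (basePt_mem_target p)] with u hu v w
    obtain ⟨D, hD⟩ := exists_fderiv_localParam_eq hf p hu
    rw [hD]
    exact diff_horizontal_minor hf hK hKext _ _ _
  obtain ⟨i, hi, β, hβ, h⟩ := exists_cylinder (smoothNear_localParam hf p (basePt_mem_target p))
    (hf.2 p) hJ
  refine ⟨i, β, ?_⟩
  have h' := (continuousAt_extChartAt (I := 𝓡 2) p).eventually h
  have h'' : ∀ᶠ q in 𝓝 p, ContDiffAt ℝ 3 β (coords (f q) i)
      ∧ coords (f q) = β (coords (f q) i) + coords (f q) 2 • coordVec 2 := by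
    filter_upwards [h', extChartAt_source_mem_nhds (I := 𝓡 2) p] with q hq hq'
    simpa only [localParam, (extChartAt (𝓡 2) p).left_inv hq'] using hq
  -- The same `β` must serve at all nearby points, and at each of them the equation must hold on a
  -- neighbourhood.
  filter_upwards [h''.eventually_nhds] with q hq
  exact ⟨hi, hβ, hq.self_of_nhds.1, hq.mono fun _ h => h.2⟩

end Surface

/-! ### Asymptotic lines -/

lemma eq_of_hasDerivWithinAt_zero {g : ℝ → ℝ} {I : Set ℝ} (hI : I.OrdConnected)
    (hu : UniqueDiffOn ℝ I) (h : ∀ s ∈ I, HasDerivWithinAt g 0 I s) {s t : ℝ} (hs : s ∈ I)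
    (ht : t ∈ I) : g s = g t := by
  refine hI.convex.is_const_of_fderivWithin_eq_zero (𝕜 := ℝ)
    (fun r hr => (h r hr).differentiableWithinAt) (fun r hr => ?_) hs ht
  rw [(h r hr).hasFDerivWithinAt.fderivWithin (hu r hr)]
  ext
  simp

section Surface

variable {M : Type*} [TopologicalSpace M] {f : M → UpperHalfPlane × ℝ}

lemma IsCylinderAt.differentiableAt_curv {p : M} {i : Fin 3} {β : ℝ → E 3}
    (hc : IsCylinderAt f p i β) : DifferentiableAt ℝ (profileCurv β) (coords (f p) i) := by
  have hy := hc.im_pos.ne'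
  have d0 (m : Fin 3) : DifferentiableAt ℝ (fun σ => β σ m) (coords (f p) i) :=
    (EuclideanSpace.proj (𝕜 := ℝ) m : E 3 →L[ℝ] ℝ).differentiableAt.comp _
      (hc.contDiffAt.differentiableAt (by simp))
  have h1 := hc.contDiffAt.derivWithin (m := 2) (by norm_num)
  have d1 (m : Fin 3) : DifferentiableAt ℝ (fun σ => deriv β σ m) (coords (f p) i) :=
    (EuclideanSpace.proj (𝕜 := ℝ) m : E 3 →L[ℝ] ℝ).differentiableAt.comp _
      (h1.differentiableAt (by simp))
  have h2 := h1.derivWithin (m := 1) (by norm_num)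
  have d2 (m : Fin 3) : DifferentiableAt ℝ (fun σ => deriv (deriv β) σ m) (coords (f p) i) :=
    (EuclideanSpace.proj (𝕜 := ℝ) m : E 3 →L[ℝ] ℝ).differentiableAt.comp _
      (h2.differentiableAt (by simp))
  unfold profileCurv profileAccel
  have hy2 := pow_ne_zero 2 hy
  exact (((((d2 0).sub ((((d1 0).const_mul 2).mul (d1 1)).div (d0 1) hy)).mul (d1 1).neg).add
    (((d2 1).add ((((d1 0).pow 2).sub ((d1 1).pow 2)).div (d0 1) hy)).mul (d1 0))).div
    ((d0 1).pow 2) hy2)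

lemma IsCylinderAt.differentiableAt_speed {p : M} {i : Fin 3}
    {β : ℝ → E 3} (hc : IsCylinderAt f p i β) :
    DifferentiableAt ℝ (profileSpeed β) (coords (f p) i) := by
  have d0 (m : Fin 3) : DifferentiableAt ℝ (fun σ => β σ m) (coords (f p) i) :=
    (EuclideanSpace.proj (𝕜 := ℝ) m : E 3 →L[ℝ] ℝ).differentiableAt.comp _
      (hc.contDiffAt.differentiableAt (by simp))
  have h1 := hc.contDiffAt.derivWithin (m := 2) (by norm_num)
  have d1 (m : Fin 3) : DifferentiableAt ℝ (fun σ => deriv β σ m) (coords (f p) i) :=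
    (EuclideanSpace.proj (𝕜 := ℝ) m : E 3 →L[ℝ] ℝ).differentiableAt.comp _
      (h1.differentiableAt (by simp))
  exact (((d1 0).pow 2).add ((d1 1).pow 2)).div ((d0 1).pow 2) (pow_ne_zero 2 hc.im_pos.ne')

variable [ChartedSpace (E 2) M] {γ : ℝ → M} {I : Set ℝ}

lemma IsAsymptoticLine.uniqueDiffOn (hγ : IsAsymptoticLine f γ I) :
    UniqueDiffOn ℝ I := by
  obtain ⟨a, ha, b, hb, hab⟩ := hγ.nondegenerate.exists_lt
  refine uniqueDiffOn_convex hγ.interval.convex ⟨(a + b) / 2, ?_⟩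
  exact mem_interior.2 ⟨Ioo a b, Ioo_subset_Icc_self.trans (hγ.interval.out ha hb), isOpen_Ioo,
    by constructor <;> linarith⟩

lemma IsAsymptoticLine.contDiffOn_coords (hf : IsSmoothImmersion f)
    (hγ : IsAsymptoticLine f γ I) : ContDiffOn ℝ 1 (fun s => coords (f (γ s))) I := by
  rw [← contMDiffOn_iff_contDiffOn]
  exact (hf.1.of_le ENat.LEInfty.out).comp_contMDiffOn hγ.contMDiffOn

lemma IsAsymptoticLine.eventually_isCylinderAt
    (hcyl : ∀ p, ∃ i β, ∀ᶠ q in 𝓝 p, IsCylinderAt f q i β) (hγ : IsAsymptoticLine f γ I)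
    {s : ℝ} (hs : s ∈ I) : ∃ i β, IsCylinderAt f (γ s) i β ∧
      ∀ᶠ r in 𝓝[I] s, IsCylinderAt f (γ r) i β := by
  obtain ⟨i, β, h⟩ := hcyl (γ s)
  exact ⟨i, β, h.self_of_nhds, (hγ.contMDiffOn s hs).continuousWithinAt.eventually h⟩

variable [IsManifold (𝓡 2) ∞ M]

/-- `velocity` uses a chart that varies with `s`; this chain rule turns it into the derivative of
one fixed curve in `ℝ³`. -/
lemma IsAsymptoticLine.hasDerivWithinAt_coords (hf : IsSmoothImmersion f)
    (hγ : IsAsymptoticLine f γ I) {s : ℝ} (hs : s ∈ I) :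
    HasDerivWithinAt (fun r => coords (f (γ r))) (diff f (γ s) (velocity γ I s)) I s := by
  have h1 : ContMDiffWithinAt 𝓘(ℝ, ℝ) 𝓘(ℝ, E 2) 1 (fun r => extChartAt (𝓡 2) (γ s) (γ r)) I s :=
    (contMDiffAt_extChartAt (I := 𝓡 2) (n := 1) (x := γ s)).comp_contMDiffWithinAt s
      (hγ.contMDiffOn s hs)
  have h2 := ((contMDiffWithinAt_iff_contDiffWithinAt.1 h1).differentiableWithinAt
    (by simp)).hasDerivWithinAt
  have h3 := ((contDiffAt_localParam hf (γ s) (basePt_mem_target _)).differentiableAt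
    (by simp)).hasFDerivAt
  have h4 := HasFDerivAt.comp_hasDerivWithinAt (f := fun r => extChartAt (𝓡 2) (γ s) (γ r)) s h3 h2
  refine h4.congr_of_eventuallyEq_of_mem ?_ hs
  filter_upwards [(hγ.contMDiffOn s hs).continuousWithinAt.preimage_mem_nhdsWithin
    (extChartAt_source_mem_nhds (I := 𝓡 2) (γ s))] with r hr
  simp only [Function.comp, localParam]
  rw [(extChartAt (𝓡 2) (γ s)).left_inv hr]

lemma IsAsymptoticLine.hasDerivWithinAt_coord (hf : IsSmoothImmersion f)
    (hγ : IsAsymptoticLine f γ I) {s : ℝ} (hs : s ∈ I) (m : Fin 3) :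
    HasDerivWithinAt (fun r => coords (f (γ r)) m) (diff f (γ s) (velocity γ I s) m) I s :=
  (EuclideanSpace.proj (𝕜 := ℝ) m : E 3 →L[ℝ] ℝ).hasFDerivAt.comp_hasDerivWithinAt s
    (hγ.hasDerivWithinAt_coords hf hs)

/-- The square of the mean curvature is constant along an asymptotic line. -/
lemma IsAsymptoticLine.exists_meanCurvature_sq_eq (hf : IsSmoothImmersion f)
    (hcyl : ∀ p, ∃ i β, ∀ᶠ q in 𝓝 p, IsCylinderAt f q i β) (hγ : IsAsymptoticLine f γ I) :
    ∃ c : ℝ, ∀ s ∈ I, ∀ N, IsUnitNormal f (γ s) N → meanCurvature f (γ s) N ^ 2 = c := by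
  have hn : ∀ p, ∃ N, IsUnitNormal f p N := fun p => by
    obtain ⟨i, β, h⟩ := hcyl p
    exact h.self_of_nhds.exists_isUnitNormal hf
  -- No continuity of `ν` is needed, since only `H²` is differentiated.
  choose ν hν using hn
  have hd : ∀ s ∈ I, HasDerivWithinAt (fun r => meanCurvature f (γ r) (ν (γ r)) ^ 2) 0 I s := by
    intro s hs
    obtain ⟨i, β, hc, he⟩ := hγ.eventually_isCylinderAt hcyl hs
    have hB := hc.speed_pos hf
    have hk := hc.differentiableAt_curv.hasDerivAt
    have hR := (hk.pow 2).div (((hc.differentiableAt_speed).hasDerivAt.pow 3).const_mul 4)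
      (mul_ne_zero four_ne_zero (pow_ne_zero 3 hB.ne'))
    have hσ := hγ.hasDerivWithinAt_coord hf hs i
    have h1 := HasDerivAt.comp_hasDerivWithinAt (h := fun r => coords (f (γ r)) i) s hR hσ
    have h2 := h1.congr_of_eventuallyEq_of_mem
      (f₁ := fun r => meanCurvature f (γ r) (ν (γ r)) ^ 2)
      (he.mono fun r hr => hr.meanCurvature_sq hf (hν _)) hs
    refine h2.congr_deriv ?_
    -- Either `σ' = 0`, or `κ = 0` and the derivative of `κ² / (4 B³)` vanishes because `κ` enters
    -- squared.
    rcases mul_eq_zero.1 (hc.diff_mul_curv_eq_zero hf (hγ.asymptotic s hs)) with h | h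
    · rw [h, mul_zero]
    · simp [h]
  obtain ⟨s₀, hs₀⟩ := hγ.nondegenerate.nonempty
  refine ⟨meanCurvature f (γ s₀) (ν (γ s₀)) ^ 2, fun s hs N hN => ?_⟩
  obtain ⟨i, β, hc, -⟩ := hγ.eventually_isCylinderAt hcyl hs
  rw [hc.meanCurvature_sq hf hN, ← hc.meanCurvature_sq hf (hν (γ s))]
  exact eq_of_hasDerivWithinAt_zero hγ.interval hγ.uniqueDiffOn hd hs hs₀

lemma IsAsymptoticLine.exists_meanCurvature_sq_eq_pos (hf : IsSmoothImmersion f)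
    (hcyl : ∀ p, ∃ i β, ∀ᶠ q in 𝓝 p, IsCylinderAt f q i β) (hγ : IsAsymptoticLine f γ I)
    (hp : ∃ s ∈ I, IsParabolic f (γ s)) :
    ∃ c : ℝ, 0 < c ∧ ∀ s ∈ I, ∀ N, IsUnitNormal f (γ s) N → meanCurvature f (γ s) N ^ 2 = c := by
  obtain ⟨c, hc⟩ := hγ.exists_meanCurvature_sq_eq hf hcyl
  refine ⟨c, ?_, hc⟩
  obtain ⟨s, hs, hsp⟩ := hp
  obtain ⟨i, β, hcy, -⟩ := hγ.eventually_isCylinderAt hcyl hs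
  obtain ⟨N, hN⟩ := hcy.exists_isUnitNormal hf
  rw [← hc s hs N hN]
  have := hcy.meanCurvature_ne_zero_of_isParabolic hf hsp hN
  positivity

/-- An asymptotic line through a parabolic point does not meet the planar points. -/
lemma IsAsymptoticLine.not_isPlanar (hf : IsSmoothImmersion f)
    (hcyl : ∀ p, ∃ i β, ∀ᶠ q in 𝓝 p, IsCylinderAt f q i β) (hγ : IsAsymptoticLine f γ I)
    (hp : ∃ s ∈ I, IsParabolic f (γ s)) {s : ℝ} (hs : s ∈ I) : ¬ IsPlanar f (γ s) := by
  intro hpl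
  obtain ⟨c, hc0, hc⟩ := hγ.exists_meanCurvature_sq_eq_pos hf hcyl hp
  obtain ⟨i, β, hcy, -⟩ := hγ.eventually_isCylinderAt hcyl hs
  obtain ⟨N, hN⟩ := hcy.exists_isUnitNormal hf
  have := hc s hs N hN
  rw [hcy.meanCurvature_eq_zero_of_isPlanar hf hpl hN] at this
  norm_num at this
  exact hc0.ne this

/-- An asymptotic line through a parabolic point has vertical velocity. -/
lemma IsAsymptoticLine.diff_velocity (hf : IsSmoothImmersion f)
    (hcyl : ∀ p, ∃ i β, ∀ᶠ q in 𝓝 p, IsCylinderAt f q i β) (hγ : IsAsymptoticLine f γ I)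
    (hp : ∃ s ∈ I, IsParabolic f (γ s)) {s : ℝ} (hs : s ∈ I) :
    (∀ m : Fin 3, m ≠ 2 → diff f (γ s) (velocity γ I s) m = 0) ∧
      diff f (γ s) (velocity γ I s) 2 ^ 2 = 1 := by
  obtain ⟨c, hc0, hc⟩ := hγ.exists_meanCurvature_sq_eq_pos hf hcyl hp
  obtain ⟨i, β, hcy, -⟩ := hγ.eventually_isCylinderAt hcyl hs
  obtain ⟨N, hN⟩ := hcy.exists_isUnitNormal hf
  have h1 := hc s hs N hN
  have h2 : profileCurv β (coords (f (γ s)) i) ≠ 0 := by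
    intro h
    rw [hcy.meanCurvature_sq hf hN, h] at h1
    norm_num at h1
    exact hc0.ne h1
  have h3 := (mul_eq_zero.1 (hcy.diff_mul_curv_eq_zero hf (hγ.asymptotic s hs))).resolve_right h2
  refine ⟨fun m hm => ?_, ?_⟩
  · rw [hcy.diff_eq hf, h3]
    simp [coordVec, hm]
  · have h4 := hγ.arcLength s hs
    rw [hcy.firstForm_eq hf, h3] at h4
    linarith

lemma IsAsymptoticLine.coords_horizontal_eq (hf : IsSmoothImmersion f)
    (hcyl : ∀ p, ∃ i β, ∀ᶠ q in 𝓝 p, IsCylinderAt f q i β) (hγ : IsAsymptoticLine f γ I)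
    (hp : ∃ s ∈ I, IsParabolic f (γ s)) {s t : ℝ} (hs : s ∈ I) (ht : t ∈ I) {m : Fin 3}
    (hm : m ≠ 2) : coords (f (γ s)) m = coords (f (γ t)) m :=
  eq_of_hasDerivWithinAt_zero hγ.interval hγ.uniqueDiffOn (fun _ hr =>
    (hγ.diff_velocity hf hcyl hp hr).1 m hm ▸ hγ.hasDerivWithinAt_coord hf hr m) hs ht

lemma IsAsymptoticLine.exists_diff_velocity_eq (hf : IsSmoothImmersion f)
    (hcyl : ∀ p, ∃ i β, ∀ᶠ q in 𝓝 p, IsCylinderAt f q i β) (hγ : IsAsymptoticLine f γ I)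
    (hp : ∃ s ∈ I, IsParabolic f (γ s)) :
    ∃ ε : ℝ, ∀ s ∈ I, diff f (γ s) (velocity γ I s) = ε • coordVec 2 := by
  have hcont : ContinuousOn (fun s => diff f (γ s) (velocity γ I s) 2) I := by
    have h1 := (hγ.contDiffOn_coords hf).continuousOn_derivWithin hγ.uniqueDiffOn le_rfl
    have h2 := (EuclideanSpace.proj (𝕜 := ℝ) (2 : Fin 3) : E 3 →L[ℝ] ℝ).continuous.comp_continuousOn
      h1
    refine h2.congr fun s hs => ?_
    rw [Function.comp, (hγ.hasDerivWithinAt_coords hf hs).derivWithin (hγ.uniqueDiffOn s hs)]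
    rfl
  -- The vertical speed is continuous with square `1` on an interval, so its sign is fixed.
  have h3 := hγ.interval.isPreconnected.eq_or_eq_neg_of_sq_eq hcont
    (continuousOn_const (c := (1 : ℝ)))
    (fun s hs => by simpa using (hγ.diff_velocity hf hcyl hp hs).2) (fun _ => one_ne_zero)
  have h4 : ∃ ε : ℝ, ∀ s ∈ I, diff f (γ s) (velocity γ I s) 2 = ε := by
    rcases h3 with h | h
    · exact ⟨1, fun s hs => h hs⟩
    · exact ⟨-1, fun s hs => h hs⟩
  obtain ⟨ε, hε⟩ := h4
  refine ⟨ε, fun s hs => ?_⟩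
  ext m
  by_cases hm : m = 2
  · subst hm
    simp [coordVec, hε s hs]
  · simp [coordVec, hm, (hγ.diff_velocity hf hcyl hp hs).1 m hm]

/-- An asymptotic line through a parabolic point is a vertical geodesic. -/
lemma IsAsymptoticLine.isGeodesicOn (hf : IsSmoothImmersion f)
    (hcyl : ∀ p, ∃ i β, ∀ᶠ q in 𝓝 p, IsCylinderAt f q i β) (hγ : IsAsymptoticLine f γ I)
    (hp : ∃ s ∈ I, IsParabolic f (γ s)) :
    IsGeodesicOn ambientMetric (fun s => coords (f (γ s))) I := by
  obtain ⟨ε, hε⟩ := hγ.exists_diff_velocity_eq hf hcyl hp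
  obtain ⟨s₀, hs₀⟩ := hγ.nondegenerate.nonempty
  have hu := hγ.uniqueDiffOn
  have hd : ∀ s ∈ I, derivWithin (fun r => coords (f (γ r))) I s = ε • coordVec 2 := by
    intro s hs
    rw [(hγ.hasDerivWithinAt_coords hf hs).derivWithin (hu s hs), hε s hs]
  have hdd : ∀ s ∈ I, derivWithin (derivWithin (fun r => coords (f (γ r))) I) I s = 0 := by
    intro s hs
    rw [derivWithin_congr hd (hd s hs)]
    simp
  refine ⟨?_, fun s hs => ?_⟩
  -- The line is given only as `C¹`; smoothness comes from its constant derivative.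
  · refine (contDiffOn_infty_iff_derivWithin hu).2
      ⟨(hγ.contDiffOn_coords hf).differentiableOn (by simp), ?_⟩
    exact contDiffOn_const.congr hd
  · rw [hdd s hs, hd s hs, christoffelVec_ambient _ _ _ (coords_im_pos _).ne', zero_add]
    ext m
    fin_cases m <;> simp [coordVec]

/-- Within one cylinder the condition on `N` involves only `σ`, which is constant along the line;
connectedness of `I` passes between different local cylinders. -/
lemma IsAsymptoticLine.isUnitNormal_iff (hf : IsSmoothImmersion f)
    (hcyl : ∀ p, ∃ i β, ∀ᶠ q in 𝓝 p, IsCylinderAt f q i β) (hγ : IsAsymptoticLine f γ I)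
    (hp : ∃ s ∈ I, IsParabolic f (γ s)) {s t : ℝ} (hs : s ∈ I) (ht : t ∈ I) (N : E 3) :
    IsUnitNormal f (γ s) N ↔ IsUnitNormal f (γ t) N := by
  refine hγ.interval.isPreconnected.induction₂
    (fun s t => IsUnitNormal f (γ s) N ↔ IsUnitNormal f (γ t) N) ?_
    (fun _ _ _ _ _ _ h1 h2 => h1.trans h2) (fun _ _ _ _ h => h.symm) hs ht
  intro r hr
  obtain ⟨i, β, hc, he⟩ := hγ.eventually_isCylinderAt hcyl hr
  filter_upwards [he, self_mem_nhdsWithin] with r' hr' hr'I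
  rw [hc.isUnitNormal_iff hf, hr'.isUnitNormal_iff hf,
    hγ.coords_horizontal_eq hf hcyl hp hr hr'I hc.ne_two]

lemma IsAsymptoticLine.continuousOn_meanCurvature (hf : IsSmoothImmersion f)
    (hcyl : ∀ p, ∃ i β, ∀ᶠ q in 𝓝 p, IsCylinderAt f q i β) (hγ : IsAsymptoticLine f γ I)
    (hp : ∃ s ∈ I, IsParabolic f (γ s)) {N : ℝ → E 3} (hN : IsUnitNormalAlong f γ I N) :
    ContinuousOn (fun s => meanCurvature f (γ s) (N s)) I := by
  intro s hs
  obtain ⟨i, β, hc, he⟩ := hγ.eventually_isCylinderAt hcyl hs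
  have hNc (m : Fin 3) : ContinuousWithinAt (fun r => N r m) I s :=
    (EuclideanSpace.proj (𝕜 := ℝ) m : E 3 →L[ℝ] ℝ).continuous.continuousAt.comp_continuousWithinAt
      (hN.1 s hs)
  have h1 : ContinuousWithinAt (fun r => profileAccel β (coords (f (γ s)) i) (N r 0) (N r 1)
      / (2 * profileSpeed β (coords (f (γ s)) i))) I s := by
    unfold profileAccel
    exact (((continuousWithinAt_const.mul (hNc 0)).add
      (continuousWithinAt_const.mul (hNc 1))).div_const _).div_const _
  refine h1.congr_of_eventuallyEq_of_mem ?_ hs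
  filter_upwards [he, self_mem_nhdsWithin] with r hr hrI
  rw [hr.meanCurvature_eq hf (hN.2 r hrI), hγ.coords_horizontal_eq hf hcyl hp hs hrI hc.ne_two]

/-- The mean curvature is a nonzero constant along an asymptotic line through a parabolic point. -/
lemma IsAsymptoticLine.exists_meanCurvature_eq (hf : IsSmoothImmersion f)
    (hcyl : ∀ p, ∃ i β, ∀ᶠ q in 𝓝 p, IsCylinderAt f q i β) (hγ : IsAsymptoticLine f γ I)
    (hp : ∃ s ∈ I, IsParabolic f (γ s)) {N : ℝ → E 3} (hN : IsUnitNormalAlong f γ I N) :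
    ∃ h : ℝ, h ≠ 0 ∧ ∀ s ∈ I, meanCurvature f (γ s) (N s) = h := by
  obtain ⟨c, hc0, hc⟩ := hγ.exists_meanCurvature_sq_eq_pos hf hcyl hp
  have hc1 : √c ≠ 0 := (Real.sqrt_pos.2 hc0).ne'
  rcases hγ.interval.isPreconnected.eq_or_eq_neg_of_sq_eq
    (hγ.continuousOn_meanCurvature hf hcyl hp hN) (continuousOn_const (c := √c))
    (fun s hs => by simpa [Real.sq_sqrt hc0.le] using hc s hs _ (hN.2 s hs)) (fun _ => hc1)
    with h | h
  · exact ⟨√c, hc1, fun s hs => h hs⟩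
  · exact ⟨-√c, neg_ne_zero.2 hc1, fun s hs => h hs⟩

end Surface

end FlatSurface

end

/-! ### The theorem -/

theorem mainTheorem3 {M : Type*} [TopologicalSpace M] [T2Space M]
    [ChartedSpace (EuclideanSpace ℝ (Fin 2)) M] [IsManifold (𝓡 2) ∞ M]
    (f : M → UpperHalfPlane × ℝ) (hf : IsSmoothImmersion f)
    (hK : ∀ p, gaussianCurvature f p = 0)
    (hKext : ∀ p N, IsUnitNormal f p N → extrinsicCurvature f p N = 0) :
    -- on a complete surface, a maximal asymptotic line through a parabolic point never meets `P`
    (IsCompleteSurface f → ∀ (γ : ℝ → M) (I : Set ℝ), IsMaximalAsymptoticLine f γ I →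
      (∃ s ∈ I, IsParabolic f (γ s)) → ∀ s ∈ I, ¬ IsPlanar f (γ s)) ∧
    ∀ (γ : ℝ → M) (I : Set ℝ), IsAsymptoticLine f γ I → (∃ s ∈ I, IsParabolic f (γ s)) →
      -- an asymptotic line through a parabolic point is a segment of an ambient geodesic
      IsGeodesicOn ambientMetric (fun s => coords (f (γ s))) I ∧
      -- the mean curvature along it
      (∃ N, IsUnitNormalAlong f γ I N) ∧
      ∀ N, IsUnitNormalAlong f γ I N →
        (∀ s ∈ I, meanCurvature f (γ s) (N s) ≠ 0) ∧
        ContDiffOn ℝ 2 (fun s => 1 / meanCurvature f (γ s) (N s)) I ∧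
        (∀ s ∈ I, iteratedDerivWithin 2 (fun r => 1 / meanCurvature f (γ r) (N r)) I s = 0) ∧
        ∃ a b : ℝ, ∀ s ∈ I, a * s + b ≠ 0 ∧ meanCurvature f (γ s) (N s) = 1 / (a * s + b) := by
  have hcyl := exists_isCylinderAt hf hK hKext
  refine ⟨fun _ γ I hγ hp s hs => hγ.1.not_isPlanar hf hcyl hp hs, fun γ I hγ hp =>
    ⟨hγ.isGeodesicOn hf hcyl hp, ?_, fun N hN => ?_⟩⟩
  · obtain ⟨s₀, hs₀⟩ := hγ.nondegenerate.nonempty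
    obtain ⟨i, β, hc, -⟩ := hγ.eventually_isCylinderAt hcyl hs₀
    obtain ⟨N, hN⟩ := hc.exists_isUnitNormal hf
    -- A normal at one point, kept constant in coordinates, is normal along the whole line.
    exact ⟨fun _ => N, continuousOn_const, fun s hs =>
      (hγ.isUnitNormal_iff hf hcyl hp hs hs₀ N).2 hN⟩
  · obtain ⟨h, h0, hH⟩ := hγ.exists_meanCurvature_eq hf hcyl hp hN
    have hinv : EqOn (fun s => 1 / meanCurvature f (γ s) (N s)) (fun _ => 1 / h) I :=
      fun s hs => by simp only [hH s hs]
    -- As `H` is the constant `h`, the affine function is `0 * s + 1 / h`.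
    refine ⟨fun s hs => (hH s hs).symm ▸ h0, contDiffOn_const.congr hinv, fun s hs => ?_,
      0, 1 / h, fun s hs => ⟨by simpa using h0, by simp [hH s hs]⟩⟩
    rw [iteratedDerivWithin_congr hinv hs, iteratedDerivWithin_const]
    simp
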